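/- Let $q$ be a prime power, let $W$ be a vector space of finite dimension $k$ over $\mathbb{F}_q$, let $0\le\ell<k$, and let $V(W,\ell)$ denote the set of $\ell$-flats ($\ell$-dimensional affine subspaces) of $W$. Let $\xi>0$ and let $S\subseteq V(W,\ell)$ be a non-empty set. All probabilities below are with respect to uniform choices. Let $\Phi(S)$ be the expansion of $S$ in the affine Grassmann graph, i.e. the probability that $A_2\notin S$ when $A\in S$ is random, $B\supseteq A$ is a random $(\ell+1)$-flat of $W$, and $A_2\subseteq B$ is a random $\ell$-flat. Suppose that: 1. $\mu(S):=\Pr_{A\in V(W,\ell)}[A\in S]\le\xi$; 2. $S$ is $\xi$-pseudo-random - with respect to hyperplanes: for every affine hyperplane $H\subseteq W$, a random $\ell$-flat $A\subseteq H$ satisfies $\Pr[A\in S]\le\xi$; - with respect to hyperplanes on its linear part: for every linear hyperplane $H\subseteq W$, a random $\ell$-flat $A\subseteq H$ and an independent random point $x\in W\setminus H$ satisfy $\Pr[x+A\in S]\le\xi$; - with respect to points on its linear part: for every $y\in W$, a random $\ell$-flat $A=x+A'$ ($A'$ linear) conditioned on $y\in A'$ satisfies $\Pr[A\in S]\le\xi$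 (a vacuous condition if no such flat exists); 3. $1-\Phi(S)\ge \frac1q$. Then there is a point $x\in W$ such that $$\mu(S_x):=\Pr_{A\in V(W,\ell)}[A\in S\mid x\in A]\;\ge\; 1-q^{2}\left(867\,\xi^{1/4}+q^{-\ell}\right).$$ -/

import Mathlib

noncomputable section

namespace AffGrass

open scoped Pointwise

/-- The probability that a uniformly random element of the finite set `E` lies in `T`. -/
def prob {α : Type*} (E T : Set α) : ℝ := ((E ∩ T).ncard : ℝ) / (E.ncard : ℝ)

/-- The expectation of `f a` for a uniformly random element `a` of the finite set `E`. -/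
def avg {α : Type*} (E : Set α) (f : α → ℝ) : ℝ := (∑ᶠ a ∈ E, f a) / (E.ncard : ℝ)

section

variable (F : Type*) [Field F] {V : Type*} [AddCommGroup V] [Module F V]

/-- The set of `ℓ`-flats of `V`: non-empty affine subspaces of dimension `ℓ`. -/
def flats (V : Type*) [AddCommGroup V] [Module F V] (ℓ : ℕ) : Set (AffineSubspace F V) :=
  {A | (A : Set V).Nonempty ∧ Module.finrank F A.direction = ℓ}

variable {F}

/-- The `ℓ`-flats contained in the affine subspace `W`. -/
def flatsIn (ℓ : ℕ) (W : AffineSubspace F V) : Set (AffineSubspace F V) :=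
  {A | A ∈ flats F V ℓ ∧ A ≤ W}

/-- The `ℓ`-flats containing the affine subspace `W`. -/
def flatsAbove (ℓ : ℕ) (W : AffineSubspace F V) : Set (AffineSubspace F V) :=
  {A | A ∈ flats F V ℓ ∧ W ≤ A}

/-- `μ(S)`, the uniform measure on all `ℓ`-flats. -/
def measure (ℓ : ℕ) (S : Set (AffineSubspace F V)) : ℝ := prob (flats F V ℓ) S

/-- One step of the random walk on the affine Grassmann graph on `ℓ`-flats: from `A`, move to a
uniform `(ℓ+1)`-flat `B` containing `A` and then to a uniform `ℓ`-flat contained in `B`.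
This is the probability that the step started at `A` ends in `T`. -/
def stepProb (ℓ : ℕ) (A : AffineSubspace F V) (T : Set (AffineSubspace F V)) : ℝ :=
  avg (flatsAbove (ℓ + 1) A) fun B => prob (flatsIn ℓ B) T

/-- The expansion `Φ(S)`: the probability that one step of the walk started at a uniform element
of `S` ends outside `S`. (Meaningful for non-empty `S`.) -/
def expansion (ℓ : ℕ) (S : Set (AffineSubspace F V)) : ℝ :=
  avg S fun A => stepProb ℓ A Sᶜ

/-- `μ(S_W)` for an affine hyperplane `W`. -/
def measureHyperplane (ℓ : ℕ) (S : Set (AffineSubspace F V)) (W : AffineSubspace F V) : ℝ :=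
  prob (flatsIn ℓ W) S

/-- `μ(S_{W,lin})` for a linear hyperplane `W`: the probability that `x + A ∈ S` for a uniform
`ℓ`-flat `A ⊆ W` and an independent uniform `x ∉ W`. -/
def measureHyperplaneLin (ℓ : ℕ) (S : Set (AffineSubspace F V)) (W : Submodule F V) : ℝ :=
  prob (flatsIn ℓ W.toAffineSubspace ×ˢ {x : V | x ∉ W})
    {p : AffineSubspace F V × V | p.2 +ᵥ p.1 ∈ S}

/-- `μ(S_x)`: the density of `S` among the `ℓ`-flats containing the point `x`. -/
def measurePoint (ℓ : ℕ) (S : Set (AffineSubspace F V)) (x : V) : ℝ :=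
  prob {A | A ∈ flats F V ℓ ∧ x ∈ A} S

/-- `μ(S_{y,lin})`: the density of `S` among the `ℓ`-flats whose linear part contains `y`. -/
def measurePointLin (ℓ : ℕ) (S : Set (AffineSubspace F V)) (y : V) : ℝ :=
  prob {A | A ∈ flats F V ℓ ∧ y ∈ A.direction} S

/-- `ξ`-pseudo-randomness with respect to (affine) hyperplanes. -/
def PseudoRandomHyperplanes (ℓ : ℕ) (ξ : ℝ) (S : Set (AffineSubspace F V)) : Prop :=
  ∀ W ∈ flats F V (Module.finrank F V - 1), measureHyperplane ℓ S W ≤ ξ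

/-- `ξ`-pseudo-randomness with respect to hyperplanes on the linear part. -/
def PseudoRandomHyperplanesLin (ℓ : ℕ) (ξ : ℝ) (S : Set (AffineSubspace F V)) : Prop :=
  ∀ W : Submodule F V, Module.finrank F W = Module.finrank F V - 1 →
    measureHyperplaneLin ℓ S W ≤ ξ

/-- `ξ`-pseudo-randomness with respect to points on the linear part. -/
def PseudoRandomPointsLin (ℓ : ℕ) (ξ : ℝ) (S : Set (AffineSubspace F V)) : Prop :=
  ∀ y : V, measurePointLin ℓ S y ≤ ξ

end

end AffGrass

end

/-! Flats are replaced by frames. A base point together with a basis of the direction is a point of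
the abelian group `Fin (ℓ + 1) → V`, every `ℓ`-flat has the same number of frames, and `S` becomes
the 0/1 function f = `frameInd ℓ S`, of mean M ≤ ξ. On this group consider the walk `v ↦ v + tens a
w` with `a`, `w` uniform. It is diagonal in the characters: the eigenvalue at χ is q^(-r), where r
is the codimension of `charKer χ`. Characters with r = 1 are exactly the non-trivial ones of the
form `pull c ψ`, that is, those factoring through one linear combination `dot c v`, with `c` taken
up to scalars.

The hypothesis on expansion makes the return probability of this walk at least about M/q
(`le_expect_walk`). Spectrally (`expect_walk_le`) it is at most M² + (1/q - 1/q²)W + M/q², where W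
is the Fourier weight of f on characters of rank one. Hence W is nearly M
(`le_levelWeight_of_walk`): f is close in L² to its rank one part X, a sum over projective points p
of functions `comp f p` of `dot p.rep v`.

A fourth moment estimate turns this into a large conditional density. Since W = E[fX] and f is 0/1
valued, W² ≤ M E[fX²]. Write X² as a diagonal part plus an off-diagonal part and apply
Cauchy-Schwarz to each. The diagonal part contributes about ηM, where η bounds every `|dev f p.rep
z|`, because components at distinct p are independent. The off-diagonal part is negligible provided
the rank one Fourier coefficients are O(ξ q^(-ℓ)), the number of projective points being O(q^ℓ);
pseudo-randomness with respect to hyperplanes gives this (`norm_hat_frameInd_pull_le`). So η is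
close to 1.

Finally, conditioning a frame on `dot c v = z` amounts to conditioning the flat on containing the
point z / c 0 if `c 0 ≠ 0`, and on having z in its direction if `c 0 = 0` (`condE_frameInd_le`).
Densities of the second kind are at most ξ by hypothesis, so some point must have density close to
1. -/

noncomputable section

namespace AffGrass

open Finset BigOperators
open scoped LinearAlgebra.Projectivization

set_option linter.unusedSectionVars false

/-! ### Fourier analysis on a finite abelian group -/

section Fourier

variable {G : Type*} [AddCommGroup G] [Fintype G]

/-- The Fourier coefficient of a real function on a finite abelian group. -/
def hat (f : G → ℝ) (χ : AddChar G ℂ) : ℂ := 𝔼 v, (f v : ℂ) * χ v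

lemma expect_ofReal {α : Type*} [Fintype α] (f : α → ℝ) :
    ((𝔼 v, f v : ℝ) : ℂ) = 𝔼 v, (f v : ℂ) := by
  simp [Fintype.expect_eq_sum_div_card]

lemma hat_zero (f : G → ℝ) : hat f 0 = ((𝔼 v, f v : ℝ) : ℂ) := by
  simp [hat]

lemma conj_hat (f : G → ℝ) (χ : AddChar G ℂ) :
    (starRingEnd ℂ) (hat f χ) = 𝔼 v, (f v : ℂ) * χ (-v) := by
  simp [hat, Fintype.expect_eq_sum_div_card, AddChar.map_neg_eq_conj]

lemma normSq_hat (f : G → ℝ) (χ : AddChar G ℂ) :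
    ((‖hat f χ‖ ^ 2 : ℝ) : ℂ) = 𝔼 v, 𝔼 u, (f v : ℂ) * (f u : ℂ) * χ (v - u) := by
  have h : ((‖hat f χ‖ ^ 2 : ℝ) : ℂ) = hat f χ * (starRingEnd ℂ) (hat f χ) := by
    rw [Complex.mul_conj, Complex.normSq_eq_norm_sq]
  rw [h, conj_hat, hat, Fintype.expect_mul_expect]
  refine expect_congr rfl fun v _ => expect_congr rfl fun u _ => ?_
  rw [sub_eq_add_neg, AddChar.map_add_eq_mul]
  ring

/-- The autocorrelation of `f` has Fourier coefficients `‖hat f χ‖ ^ 2`. -/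
lemma sum_normSq_hat_mul (f : G → ℝ) (u : G) :
    ∑ χ : AddChar G ℂ, ((‖hat f χ‖ ^ 2 : ℝ) : ℂ) * χ u = 𝔼 v, (f v : ℂ) * (f (v + u) : ℂ) := by
  classical
  simp_rw [normSq_hat, expect_mul]
  rw [← expect_sum_comm]
  refine expect_congr rfl fun v _ => ?_
  rw [← expect_sum_comm]
  have h : ∀ w : G, ∑ χ : AddChar G ℂ, (f v : ℂ) * (f w : ℂ) * χ (v - w) * χ u =
      if w = v + u then (Fintype.card G : ℂ) * ((f v : ℂ) * (f w : ℂ)) else 0 := by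
    intro w
    have : ∀ χ : AddChar G ℂ, (f v : ℂ) * (f w : ℂ) * χ (v - w) * χ u =
        (f v : ℂ) * (f w : ℂ) * χ (v - w + u) := by
      intro χ
      rw [AddChar.map_add_eq_mul]
      ring
    simp_rw [this]
    rw [← mul_sum, AddChar.sum_apply_eq_ite]
    have e : v - w + u = 0 ↔ w = v + u := by
      constructor
      · intro h
        have : v + u - w = 0 := by rw [← h]; abel
        exact (sub_eq_zero.1 this).symm
      · rintro rfl
        abel
    simp only [e]
    split_ifs <;> ring
  simp_rw [h]
  rw [Fintype.expect_eq_sum_div_card]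
  simp

lemma sum_normSq_hat (f : G → ℝ) : ∑ χ : AddChar G ℂ, ‖hat f χ‖ ^ 2 = 𝔼 v, f v ^ 2 := by
  have h := sum_normSq_hat_mul f 0
  apply Complex.ofReal_injective
  rw [expect_ofReal]
  simpa [sq] using h

/-- `hat` pairs with χ rather than with its conjugate, so the inversion formula carries the sign
`-u`. -/
lemma fourier_inversion (f : G → ℝ) (u : G) :
    (f u : ℂ) = ∑ χ : AddChar G ℂ, hat f χ * χ (-u) := by
  classical
  simp_rw [hat, expect_mul]
  rw [← expect_sum_comm]
  have h : ∀ v : G, ∑ χ : AddChar G ℂ, (f v : ℂ) * χ v * χ (-u) =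
      if v = u then (Fintype.card G : ℂ) * (f v : ℂ) else 0 := by
    intro v
    simp_rw [mul_assoc, ← AddChar.map_add_eq_mul]
    rw [← mul_sum, AddChar.sum_apply_eq_ite]
    simp only [add_neg_eq_zero]
    split_ifs <;> ring
  simp_rw [h]
  rw [Fintype.expect_eq_sum_div_card]
  simp

end Fourier

/-! ### Linear combinations of a uniform family of vectors, and their independence -/

section Dot

variable {F : Type*} [Field F] {V : Type*} [AddCommGroup V] [Module F V]
  {ι : Type*} [Fintype ι]

/-- The linear combination of the vectors `v i` with coefficients `c i`. -/
def dot (c : ι → F) (v : ι → V) : V := ∑ i, c i • v i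

/-- The rank one family `i ↦ a i • w`. -/
def tens (a : ι → F) (w : V) : ι → V := fun i => a i • w

lemma dot_add (c : ι → F) (v u : ι → V) : dot c (v + u) = dot c v + dot c u := by
  simp [dot, sum_add_distrib]

lemma add_dot (c d : ι → F) (v : ι → V) : dot (c + d) v = dot c v + dot d v := by
  simp [dot, add_smul, sum_add_distrib]

lemma smul_dot (s : F) (c : ι → F) (v : ι → V) : dot (s • c) v = s • dot c v := by
  simp [dot, smul_sum, mul_smul]

lemma zero_dot (v : ι → V) : dot (0 : ι → F) v = 0 := by
  simp [dot]

lemma dot_tens (c a : ι → F) (w : V) : dot c (tens a w) = (c ⬝ᵥ a) • w := by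
  simp [dot, tens, dotProduct, sum_smul, mul_smul]

lemma tens_add (a b : ι → F) (w : V) : tens (a + b) w = tens a w + tens b w := by
  ext i; simp [tens, add_smul]

lemma tens_add_right (a : ι → F) (w x : V) : tens a (w + x) = tens a w + tens a x := by
  ext i; simp [tens]

lemma tens_smul (s : F) (a : ι → F) (w : V) : tens (s • a) w = tens a (s • w) := by
  ext i; simp [tens, mul_smul, smul_comm s (a i)]

/-- Every family is a sum of rank one families, so a character is determined by its values on these.
This lets statements about characters be checked on `tens` alone. -/
lemma char_eq_prod [DecidableEq ι] (χ : AddChar (ι → V) ℂ) (v : ι → V) :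
    χ v = ∏ i, χ (tens (Pi.single i (1 : F)) (v i)) := by
  have h : v = ∑ i, tens (Pi.single i (1 : F)) (v i) := by
    ext j
    simp [tens, Finset.sum_apply, Pi.single_apply]
  have h2 : ∀ s : Finset ι, χ (∑ i ∈ s, tens (Pi.single i (1 : F)) (v i)) =
      ∏ i ∈ s, χ (tens (Pi.single i (1 : F)) (v i)) := by
    intro s
    induction s using Finset.induction_on with
    | empty => simp
    | insert a s ha ih => rw [sum_insert ha, prod_insert ha, AddChar.map_add_eq_mul, ih]
  conv_lhs => rw [h]
  exact h2 univ

/-- `dot c` as an additive homomorphism. -/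
def dotHom (V : Type*) [AddCommGroup V] [Module F V] (c : ι → F) : (ι → V) →+ V where
  toFun := dot c
  map_zero' := by simp [dot]
  map_add' := dot_add c

@[simp] lemma dotHom_apply (c : ι → F) (v : ι → V) : dotHom V c v = dot c v := rfl

/-- The character `v ↦ ψ (dot c v)`. -/
def pull (c : ι → F) (ψ : AddChar V ℂ) : AddChar (ι → V) ℂ := ψ.compAddMonoidHom (dotHom V c)

@[simp] lemma pull_apply (c : ι → F) (ψ : AddChar V ℂ) (v : ι → V) :
    pull c ψ v = ψ (dot c v) := rfl

/-- A functional that vanishes on `K` but not at `d`, written as a dot product and normalised at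
`d`. -/
lemma exists_dual_vector {K : Submodule F (ι → F)} {d : ι → F} (hd : d ∉ K) :
    ∃ u : ι → F, (∀ a ∈ K, a ⬝ᵥ u = 0) ∧ d ⬝ᵥ u = 1 := by
  classical
  obtain ⟨φ, hφ, hK⟩ := Submodule.exists_le_ker_of_notMem hd
  have key : ∀ a : ι → F, φ a = a ⬝ᵥ fun i => φ (Pi.single i 1) := by
    intro a
    conv_lhs => rw [pi_eq_sum_univ' a]
    simp [dotProduct]
  refine ⟨fun i => (φ d)⁻¹ * φ (Pi.single i 1), fun a ha => ?_, ?_⟩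
  · have h0 : φ a = 0 := hK ha
    rw [key] at h0
    have : (a ⬝ᵥ fun i => (φ d)⁻¹ * φ (Pi.single i 1)) =
        (φ d)⁻¹ * (a ⬝ᵥ fun i => φ (Pi.single i 1)) := by
      simp only [dotProduct, mul_sum]
      exact sum_congr rfl fun i _ => by ring
    rw [this, h0, mul_zero]
  · have : (d ⬝ᵥ fun i => (φ d)⁻¹ * φ (Pi.single i 1)) =
        (φ d)⁻¹ * (d ⬝ᵥ fun i => φ (Pi.single i 1)) := by
      simp only [dotProduct, mul_sum]
      exact sum_congr rfl fun i _ => by ring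
    rw [this, ← key, inv_mul_cancel₀ hφ]

variable [Fintype V] [DecidableEq ι]

/-- `dot d v` is uniform and independent of `dot a v`, `dot b v`, `dot c v` when `d` is not in the
span of `a`, `b`, `c`. -/
lemma expect_resample {R : Type*} [AddCommMonoid R] [Module ℚ≥0 R] {a b c d : ι → F}
    (hd : d ∉ Submodule.span F {a, b, c}) (Φ : V → V → V → V → R) :
    𝔼 v : ι → V, Φ (dot a v) (dot b v) (dot c v) (dot d v) =
      𝔼 v : ι → V, 𝔼 x, Φ (dot a v) (dot b v) (dot c v) x := by
  obtain ⟨u, hu, hdu⟩ := exists_dual_vector hd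
  have ha := hu a (Submodule.subset_span (by simp))
  have hb := hu b (Submodule.subset_span (by simp))
  have hc := hu c (Submodule.subset_span (by simp))
  -- With `u` orthogonal to `a`, `b`, `c` and `d ⬝ᵥ u = 1`, translation by `tens u w` preserves the
  -- uniform measure, fixes the first three combinations and shifts the fourth by `w`.
  have h : ∀ w : V, 𝔼 v : ι → V, Φ (dot a v) (dot b v) (dot c v) (dot d v) =
      𝔼 v : ι → V, Φ (dot a v) (dot b v) (dot c v) (dot d v + w) := by
    intro w
    refine (Fintype.expect_equiv (Equiv.addRight (tens u w)) _ _ fun v => ?_).symm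
    simp [dot_add, dot_tens, ha, hb, hc, hdu]
  calc _ = 𝔼 _w : V, 𝔼 v : ι → V, Φ (dot a v) (dot b v) (dot c v) (dot d v) := by
        rw [Fintype.expect_const]
    _ = 𝔼 w : V, 𝔼 v : ι → V, Φ (dot a v) (dot b v) (dot c v) (dot d v + w) :=
        expect_congr rfl fun w _ => h w
    _ = _ := by
        rw [expect_comm]
        refine expect_congr rfl fun v _ => ?_
        exact Fintype.expect_equiv (Equiv.addLeft (dot d v)) _ _ fun _ => rfl

lemma expect_dot {R : Type*} [AddCommMonoid R] [Module ℚ≥0 R] {a : ι → F} (ha : a ≠ 0)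
    (Φ : V → R) : 𝔼 v : ι → V, Φ (dot a v) = 𝔼 x, Φ x := by
  have h := expect_resample (V := V) (a := 0) (b := 0) (c := 0) (d := a) (by simpa using ha)
    fun _ _ _ x => Φ x
  rw [h, Fintype.expect_const]

lemma expect_dot_two {R : Type*} [AddCommMonoid R] [Module ℚ≥0 R] {a b : ι → F} (ha : a ≠ 0)
    (hb : b ∉ Submodule.span F {a}) (Φ : V → V → R) :
    𝔼 v : ι → V, Φ (dot a v) (dot b v) = 𝔼 x, 𝔼 y, Φ x y := by
  have h := expect_resample (V := V) (a := a) (b := a) (c := a) (d := b) (by simpa using hb)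
    fun x _ _ y => Φ x y
  rw [h, expect_dot ha fun x => 𝔼 y, Φ x y]

lemma expect_dot_three {R : Type*} [AddCommMonoid R] [Module ℚ≥0 R] {a b c : ι → F} (ha : a ≠ 0)
    (hb : b ∉ Submodule.span F {a}) (hc : c ∉ Submodule.span F {a, b}) (Φ : V → V → V → R) :
    𝔼 v : ι → V, Φ (dot a v) (dot b v) (dot c v) = 𝔼 x, 𝔼 y, 𝔼 z, Φ x y z := by
  have h := expect_resample (V := V) (a := a) (b := b) (c := b) (d := c) (by simpa using hc)
    fun x y _ z => Φ x y z
  rw [h, expect_dot_two ha hb fun x y => 𝔼 z, Φ x y z]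

end Dot

/-! ### Conditioning on one linear combination -/

section Conditional

variable {F : Type*} [Field F] {V : Type*} [AddCommGroup V] [Module F V] [Fintype V]
  {ι : Type*} [Fintype ι] [DecidableEq ι]

open Classical in
/-- The conditional expectation of `f v` given `dot c v = z` (for `c ≠ 0`). -/
def condE (f : (ι → V) → ℝ) (c : ι → F) (z : V) : ℝ :=
  -- The factor is the reciprocal of the probability of `dot c v = z`, which is 1/|V| when `c ≠ 0`.
  Fintype.card V * 𝔼 v, if dot c v = z then f v else 0

/-- The deviation of the conditional expectation given `dot c v = z` from the mean. -/
def dev (f : (ι → V) → ℝ) (c : ι → F) (z : V) : ℝ := condE f c z - 𝔼 v, f v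

lemma expect_condE_mul (f : (ι → V) → ℝ) (c : ι → F) (Φ : V → ℂ) :
    𝔼 z, (condE f c z : ℂ) * Φ z = 𝔼 v, (f v : ℂ) * Φ (dot c v) := by
  classical
  have h : ∀ z : V, (condE f c z : ℂ) * Φ z =
      𝔼 v, if dot c v = z then Fintype.card V * (f v * Φ z) else 0 := by
    intro z
    rw [condE, Complex.ofReal_mul, expect_ofReal, mul_assoc, expect_mul, mul_expect]
    refine expect_congr rfl fun v _ => ?_
    split_ifs <;> simp
  simp_rw [h]
  rw [expect_comm]
  refine expect_congr rfl fun v _ => ?_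
  rw [Fintype.expect_eq_sum_div_card]
  simp

lemma expect_condE_mul_real (f : (ι → V) → ℝ) (c : ι → F) (Φ : V → ℝ) :
    𝔼 z, condE f c z * Φ z = 𝔼 v, f v * Φ (dot c v) := by
  apply Complex.ofReal_injective
  rw [expect_ofReal, expect_ofReal]
  simpa using expect_condE_mul f c fun z => (Φ z : ℂ)

lemma expect_dev (f : (ι → V) → ℝ) (c : ι → F) : 𝔼 z, dev f c z = 0 := by
  have h := expect_condE_mul_real f c fun _ => 1
  simp only [mul_one] at h
  simp [dev, expect_sub_distrib, h]

/-- Conditional expectation is self-adjoint, and subtracting the mean changes nothing because the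
deviation has mean zero: the component of f along `c` behaves as an orthogonal projection. -/
lemma expect_mul_dev (f : (ι → V) → ℝ) (c : ι → F) :
    𝔼 v, f v * dev f c (dot c v) = 𝔼 z, dev f c z ^ 2 := by
  rw [← expect_condE_mul_real]
  have h : ∀ z, condE f c z * dev f c z = dev f c z ^ 2 + (𝔼 v, f v) * dev f c z := by
    intro z
    simp only [dev]
    ring
  simp_rw [h, expect_add_distrib, ← mul_expect, expect_dev, mul_zero, add_zero]

lemma hat_dev_zero (f : (ι → V) → ℝ) (c : ι → F) : hat (dev f c) 0 = 0 := by
  rw [hat_zero, expect_dev, Complex.ofReal_zero]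

/-- Conditioning on `dot c v` retains exactly the coefficients of f at the characters factoring
through `dot c`; subtracting the mean only affects the trivial one. -/
lemma hat_dev (f : (ι → V) → ℝ) (c : ι → F) {ψ : AddChar V ℂ} (hψ : ψ ≠ 0) :
    hat (dev f c) ψ = hat f (pull c ψ) := by
  have h := expect_condE_mul f c ψ
  have h0 : 𝔼 z, ψ z = 0 := AddChar.expect_eq_zero_iff_ne_zero.2 hψ
  simp only [hat, dev, Complex.ofReal_sub, sub_mul, expect_sub_distrib, h, ← mul_expect, h0,
    mul_zero, sub_zero, pull_apply]

lemma sum_normSq_hat_pull (f : (ι → V) → ℝ) (c : ι → F) :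
    ∑ ψ ∈ univ.filter (fun ψ : AddChar V ℂ => ψ ≠ 0), ‖hat f (pull c ψ)‖ ^ 2 =
      𝔼 z, dev f c z ^ 2 := by
  rw [← sum_normSq_hat, sum_filter]
  refine sum_congr rfl fun ψ _ => ?_
  split_ifs with h
  · rw [hat_dev f c h]
  · rw [not_not.1 h, hat_dev_zero]
    simp

end Conditional

lemma natCard_submodule {F : Type*} [Field F] [Fintype F] {E : Type*} [AddCommGroup E] [Module F E] [Finite E]
    (K : Submodule F E) : Nat.card K = Fintype.card F ^ Module.finrank F K := by
  rw [Module.natCard_eq_pow_finrank (K := F), Nat.card_eq_fintype_card]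

/-! ### Spectrum of the rank one walk -/

section Spectral

variable {F : Type*} [Field F] [Fintype F] {V : Type*} [AddCommGroup V] [Module F V] [Fintype V]
  {ι : Type*} [Fintype ι] [DecidableEq ι]

instance : Fintype (ℙ F (ι → F)) := Fintype.ofFinite _

/-- The coefficient vectors `a` for which the character `χ` is trivial on all `tens a w`. -/
def charKer (χ : AddChar (ι → V) ℂ) : Submodule F (ι → F) where
  carrier := {a | ∀ w : V, χ (tens a w) = 1}
  zero_mem' := by
    intro w
    have : tens (0 : ι → F) w = 0 := by ext i; simp [tens]
    simp [this]
  add_mem' := by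
    intro a b ha hb w
    rw [tens_add, AddChar.map_add_eq_mul, ha, hb, one_mul]
  smul_mem' := by
    intro s a ha w
    rw [tens_smul]
    exact ha _

lemma mem_charKer {χ : AddChar (ι → V) ℂ} {a : ι → F} :
    a ∈ charKer χ ↔ ∀ w : V, χ (tens a w) = 1 := Iff.rfl

/-- The character `w ↦ χ (tens a w)`. -/
def tensChar (χ : AddChar (ι → V) ℂ) (a : ι → F) : AddChar V ℂ where
  toFun w := χ (tens a w)
  map_zero_eq_one' := by
    have : tens a (0 : V) = 0 := by ext i; simp [tens]
    simp [this]
  map_add_eq_mul' w x := by rw [tens_add_right, AddChar.map_add_eq_mul]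

/-- The eigenvalue at `χ` of the walk that adds a uniform `tens a w`. -/
def eig (F : Type*) [Field F] [Fintype F] [Module F V] (χ : AddChar (ι → V) ℂ) : ℝ :=
  (Nat.card (charKer (F := F) χ) : ℝ) / Fintype.card (ι → F)

/-- For fixed `a` the average over `w` is that of the character `tensChar χ a`, hence 1 or 0
according to whether `a` lies in `charKer χ`. -/
lemma expect_char_tens (χ : AddChar (ι → V) ℂ) :
    𝔼 a : ι → F, 𝔼 w : V, χ (tens a w) = (eig F χ : ℂ) := by
  classical
  have h : ∀ a : ι → F, 𝔼 w : V, χ (tens a w) = if a ∈ charKer χ then 1 else 0 := by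
    intro a
    have h0 := AddChar.expect_eq_ite (tensChar χ a)
    have e : tensChar χ a = 0 ↔ a ∈ charKer χ := by
      rw [AddChar.eq_zero_iff]; rfl
    simp only [e] at h0
    exact h0
  simp_rw [h]
  rw [Fintype.expect_eq_sum_div_card, eig, Nat.card_eq_fintype_card]
  simp [Fintype.card_subtype]

lemma char_eq_zero_of_charKer_eq_top {χ : AddChar (ι → V) ℂ} (h : charKer (F := F) χ = ⊤) :
    χ = 0 := by
  rw [AddChar.eq_zero_iff]
  intro v
  rw [char_eq_prod (F := F)]
  refine prod_eq_one fun i _ => ?_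
  have : Pi.single i (1 : F) ∈ charKer (F := F) χ := by rw [h]; trivial
  exact this _

/-- A character that is trivial on `tens a w` for all `a` orthogonal to `c ≠ 0` factors through
`dot c`. -/
lemma exists_eq_pull {χ : AddChar (ι → V) ℂ} {c : ι → F} (hc : c ≠ 0)
    (h : ∀ a : ι → F, c ⬝ᵥ a = 0 → a ∈ charKer χ) : ∃ ψ : AddChar V ℂ, χ = pull c ψ := by
  obtain ⟨u, -, hu⟩ := exists_dual_vector (K := ⊥) (d := c) (by simpa using hc)
  refine ⟨tensChar χ u, ?_⟩
  ext v
  rw [pull_apply]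
  change _ = χ (tens u (dot c v))
  -- Since `c ⬝ᵥ u = 1`, the vector e_i - c_i u is orthogonal to `c`, so χ cannot distinguish e_i
  -- from c_i u.
  have h1 : ∀ i, χ (tens (Pi.single i (1 : F)) (v i)) = χ (tens (c i • u) (v i)) := by
    intro i
    have h2 : Pi.single i (1 : F) - c i • u ∈ charKer χ := by
      apply h
      rw [dotProduct_sub, dotProduct_smul, hu]
      simp
    have h3 : Pi.single i (1 : F) = (Pi.single i (1 : F) - c i • u) + c i • u := by abel
    rw [h3, tens_add, AddChar.map_add_eq_mul, h2, one_mul]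
  rw [char_eq_prod (F := F)]
  simp_rw [h1]
  have h4 : ∀ s : Finset ι, ∏ i ∈ s, χ (tens (c i • u) (v i)) = χ (tens u (∑ i ∈ s, c i • v i)) := by
    intro s
    induction s using Finset.induction_on with
    | empty =>
      have : tens u (0 : V) = 0 := by ext i; simp [tens]
      simp [this]
    | insert a s ha ih =>
      rw [sum_insert ha, prod_insert ha, tens_add_right, AddChar.map_add_eq_mul, ih, tens_smul]
  exact h4 univ

lemma eig_eq_one_of_zero : eig F (0 : AddChar (ι → V) ℂ) = 1 := by
  have h : charKer (F := F) (0 : AddChar (ι → V) ℂ) = ⊤ := by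
    ext a; simp [mem_charKer]
  rw [eig, h]
  simp

/-- The eigenvalue of a non-trivial character is at most `1 / q ^ 2`, unless the character factors
through some `dot c`, in which case it is at most `1 / q`. -/
lemma eig_le {χ : AddChar (ι → V) ℂ} (hχ : χ ≠ 0) :
    eig F χ ≤ 1 / (Fintype.card F : ℝ) ^ 2 ∨
      (eig F χ ≤ 1 / (Fintype.card F : ℝ) ∧ ∃ p : ℙ F (ι → F), ∃ ψ : AddChar V ℂ,
        ψ ≠ 0 ∧ χ = pull p.rep ψ) := by
  have hq : (1 : ℝ) < Fintype.card F := by exact_mod_cast Fintype.one_lt_card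
  have hq0 : (0 : ℝ) < Fintype.card F := by linarith
  have hcard : (Fintype.card (ι → F) : ℝ) =
      (Fintype.card F : ℝ) ^ Module.finrank F (ι → F) := by
    simp
  have hbound : ∀ j, Module.finrank F (charKer (F := F) χ) + j ≤ Module.finrank F (ι → F) →
      eig F χ ≤ 1 / (Fintype.card F : ℝ) ^ j := by
    intro j hj
    rw [eig, natCard_submodule, hcard, div_le_div_iff₀ (by positivity) (by positivity), one_mul]
    push_cast
    rw [← pow_add]
    exact pow_le_pow_right₀ hq.le hj
  have hlt : charKer (F := F) χ < ⊤ :=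
    lt_top_iff_ne_top.2 fun h => hχ (char_eq_zero_of_charKer_eq_top h)
  obtain ⟨d, hd⟩ : ∃ d, d ∉ charKer (F := F) χ := by
    by_contra! h
    exact hlt.ne (eq_top_iff.2 fun x _ => h x)
  obtain ⟨c, hc, hdc⟩ := exists_dual_vector hd
  let Kc : Submodule F (ι → F) := LinearMap.ker (dotProductBilin F F c)
  have hmem : ∀ a, a ∈ Kc ↔ c ⬝ᵥ a = 0 := fun a => by simp [Kc]
  have hle : charKer χ ≤ Kc := fun a ha => by
    rw [hmem, dotProduct_comm]; exact hc a ha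
  have hKc : Kc < ⊤ := by
    refine lt_top_iff_ne_top.2 fun h => ?_
    have : d ∈ Kc := by rw [h]; trivial
    rw [hmem, dotProduct_comm, hdc] at this
    exact one_ne_zero this
  have hKcr := Submodule.finrank_lt hKc.ne
  -- `charKer χ` is proper and contained in the hyperplane orthogonal to `c`. Equality is the rank
  -- one case; a strict inclusion gives codimension at least 2.
  rcases hle.eq_or_lt with h | h
  · right
    refine ⟨?_, ?_⟩
    · have := hbound 1 (by rw [h]; omega)
      simpa using this
    · have hc0 : c ≠ 0 := by rintro rfl; simp at hdc
      obtain ⟨s, hs⟩ := Projectivization.exists_smul_eq_mk_rep F c hc0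
      obtain ⟨ψ, hψ⟩ := exists_eq_pull (χ := χ)
        (Projectivization.rep_nonzero (Projectivization.mk F c hc0)) (by
          intro a ha
          rw [h, hmem]
          rw [← hs, Units.smul_def, smul_dotProduct, smul_eq_mul] at ha
          simpa using ha)
      refine ⟨_, ψ, ?_, hψ⟩
      rintro rfl
      apply hχ
      rw [hψ]
      ext v
      simp
  · left
    have := Submodule.finrank_lt_finrank_of_lt h
    exact hbound 2 (by omega)

/-- Spectral upper bound for the return probability of the walk that adds a uniform `tens a w`. -/
lemma expect_walk_le (f : (ι → V) → ℝ) :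
    𝔼 a : ι → F, 𝔼 w : V, 𝔼 v, f v * f (v + tens a w) ≤
      (𝔼 v, f v) ^ 2 +
        (1 / (Fintype.card F : ℝ) - 1 / (Fintype.card F : ℝ) ^ 2) *
          ∑ p : ℙ F (ι → F), 𝔼 z, dev f p.rep z ^ 2 +
        1 / (Fintype.card F : ℝ) ^ 2 * 𝔼 v, f v ^ 2 := by
  classical
  have hq : (1 : ℝ) < Fintype.card F := by exact_mod_cast Fintype.one_lt_card
  set q : ℝ := (Fintype.card F : ℝ)
  have hq0 : 0 < q := by linarith
  have hd : 0 ≤ 1 / q - 1 / q ^ 2 := by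
    rw [sub_nonneg]
    exact one_div_le_one_div_of_le hq0 (by nlinarith)
  have e : 𝔼 a : ι → F, 𝔼 w : V, 𝔼 v, f v * f (v + tens a w) =
      ∑ χ : AddChar (ι → V) ℂ, ‖hat f χ‖ ^ 2 * eig F χ := by
    apply Complex.ofReal_injective
    simp_rw [expect_ofReal, Complex.ofReal_mul]
    simp_rw [← sum_normSq_hat_mul, expect_sum_comm, ← mul_expect, expect_char_tens]
    push_cast
    rfl
  -- The double sum counts representations of χ as `pull p.rep ψ`. Only its being at least 1 on rank
  -- one characters matters, so uniqueness of the representation is not needed.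
  have hpt : ∀ χ : AddChar (ι → V) ℂ, eig F χ ≤ (if χ = 0 then 1 else 0) +
      (1 / q - 1 / q ^ 2) * (∑ p : ℙ F (ι → F),
        ∑ ψ ∈ univ.filter (fun ψ : AddChar V ℂ => ψ ≠ 0), if χ = pull p.rep ψ then (1 : ℝ) else 0) +
        1 / q ^ 2 := by
    intro χ
    have hnn : 0 ≤ ∑ p : ℙ F (ι → F), ∑ ψ ∈ univ.filter (fun ψ : AddChar V ℂ => ψ ≠ 0),
        if χ = pull p.rep ψ then (1 : ℝ) else 0 :=
      sum_nonneg fun _ _ => sum_nonneg fun _ _ => by split_ifs <;> norm_num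
    have hq2 : 0 < 1 / q ^ 2 := by positivity
    by_cases hχ : χ = 0
    · rw [if_pos hχ, hχ, eig_eq_one_of_zero]
      rw [hχ] at hnn
      nlinarith [mul_nonneg hd hnn]
    · rw [if_neg hχ]
      rcases eig_le (F := F) hχ with h | ⟨h, p, ψ, hψ, hp⟩
      · nlinarith [mul_nonneg hd hnn]
      · have h1 : 1 ≤ ∑ p : ℙ F (ι → F), ∑ ψ ∈ univ.filter (fun ψ : AddChar V ℂ => ψ ≠ 0),
            if χ = pull p.rep ψ then (1 : ℝ) else 0 := by
          have a1 : (if χ = pull p.rep ψ then (1 : ℝ) else 0) ≤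
              ∑ ψ ∈ univ.filter (fun ψ : AddChar V ℂ => ψ ≠ 0),
                if χ = pull p.rep ψ then (1 : ℝ) else 0 :=
            single_le_sum (f := fun ψ => if χ = pull p.rep ψ then (1 : ℝ) else 0)
              (fun _ _ => by split_ifs <;> norm_num) (by simpa using hψ)
          have a2 := single_le_sum (f := fun p : ℙ F (ι → F) =>
            ∑ ψ ∈ univ.filter (fun ψ : AddChar V ℂ => ψ ≠ 0),
                if χ = pull p.rep ψ then (1 : ℝ) else 0)
              (fun _ _ => sum_nonneg fun _ _ => by split_ifs <;> norm_num) (mem_univ p)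
          rw [if_pos hp] at a1
          exact a1.trans a2
        have h2 := mul_le_mul_of_nonneg_left h1 hd
        change eig F χ ≤ 1 / q at h
        linarith
  rw [e]
  calc ∑ χ : AddChar (ι → V) ℂ, ‖hat f χ‖ ^ 2 * eig F χ
      ≤ ∑ χ : AddChar (ι → V) ℂ, ‖hat f χ‖ ^ 2 * _ :=
        sum_le_sum fun χ _ => mul_le_mul_of_nonneg_left (hpt χ) (by positivity)
    _ = _ := by
      simp_rw [mul_add, sum_add_distrib]
      congr 1
      · congr 1
        · simp only [mul_ite, mul_one, mul_zero, sum_ite_eq', mem_univ, if_true, hat_zero,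
            Complex.norm_real, Real.norm_eq_abs, sq_abs]
        · simp_rw [← sum_normSq_hat_pull, mul_sum]
          rw [sum_comm]
          refine sum_congr rfl fun p _ => ?_
          rw [sum_comm]
          refine sum_congr rfl fun ψ _ => ?_
          simp [mul_comm]
      · rw [← sum_mul, sum_normSq_hat, mul_comm]

end Spectral

/-! ### Mixed fourth moments of functions of linear combinations -/

section FourthMoment

variable {F : Type*} [Field F] [Fintype F] {V : Type*} [AddCommGroup V] [Module F V] [Fintype V]
  {ι : Type*} [Fintype ι] [DecidableEq ι]

/-- The character `x ↦ ψ (s • x)`. -/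
def smulChar (s : F) (ψ : AddChar V ℂ) : AddChar V ℂ :=
  ψ.compAddMonoidHom (DistribSMul.toAddMonoidHom V s)

@[simp] lemma smulChar_apply (s : F) (ψ : AddChar V ℂ) (x : V) : smulChar s ψ x = ψ (s • x) := rfl

lemma smulChar_injective {s : F} (hs : s ≠ 0) :
    Function.Injective (smulChar (V := V) s) := by
  intro ψ φ h
  ext x
  have := DFunLike.congr_fun h (s⁻¹ • x)
  simpa [smul_smul, mul_inv_cancel₀ hs] using this

lemma expect_mul_four_eq (g₁ g₂ g₃ g₄ : V → ℝ) (s t r : F) :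
    ((𝔼 x, 𝔼 y, 𝔼 z, g₁ x * g₂ y * g₃ z * g₄ (s • x + t • y + r • z) : ℝ) : ℂ) =
      ∑ ψ : AddChar V ℂ, hat g₄ ψ * (hat g₁ (smulChar (-s) ψ) * (hat g₂ (smulChar (-t) ψ) *
        hat g₃ (smulChar (-r) ψ))) := by
  simp_rw [expect_ofReal, Complex.ofReal_mul]
  have h : ∀ x y z : V, (g₁ x : ℂ) * g₂ y * g₃ z * g₄ (s • x + t • y + r • z) =
      ∑ ψ : AddChar V ℂ, hat g₄ ψ * ((g₁ x * ψ (-s • x)) * ((g₂ y * ψ (-t • y)) *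
        (g₃ z * ψ (-r • z)))) := by
    intro x y z
    rw [fourier_inversion g₄, mul_sum]
    refine sum_congr rfl fun ψ _ => ?_
    have e : -(s • x + t • y + r • z) = -s • x + (-t • y + -r • z) := by
      simp only [neg_smul]; abel
    rw [e, AddChar.map_add_eq_mul, AddChar.map_add_eq_mul]
    ring
  simp_rw [h, expect_sum_comm, ← mul_expect, ← expect_mul]
  rfl

/-- On the Fourier side the correlation is a single sum over ψ of four coefficients. Two are bounded
by `m`; the other two are handled by 2CD ≤ C² + D² and Parseval. As `r ≠ 0`, rescaling by `-r`
permutes the characters, so the coefficients of g₃ have full Parseval sum. -/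
lemma abs_expect_mul_four_le {g₁ g₂ : V → ℝ} (g₃ g₄ : V → ℝ) (s t : F) {r : F} (hr : r ≠ 0)
    {m : ℝ} (h₁ : ∀ ψ, ‖hat g₁ ψ‖ ≤ m) (h₂ : ∀ ψ, ‖hat g₂ ψ‖ ≤ m) :
    |𝔼 x, 𝔼 y, 𝔼 z, g₁ x * g₂ y * g₃ z * g₄ (s • x + t • y + r • z)| ≤
      m ^ 2 * ((𝔼 x, g₃ x ^ 2) + 𝔼 x, g₄ x ^ 2) / 2 := by
  have hm : 0 ≤ m := (norm_nonneg _).trans (h₁ 0)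
  rw [← Real.norm_eq_abs, ← Complex.norm_real, expect_mul_four_eq]
  have hb : ∑ ψ : AddChar V ℂ, ‖hat g₃ (smulChar (-r) ψ)‖ ^ 2 = 𝔼 x, g₃ x ^ 2 := by
    rw [← sum_normSq_hat]
    exact Fintype.sum_bijective _
      (Finite.injective_iff_bijective.1 (smulChar_injective (neg_ne_zero.2 hr))) _ _ fun _ => rfl
  calc _ ≤ ∑ ψ : AddChar V ℂ, ‖hat g₄ ψ * (hat g₁ (smulChar (-s) ψ) *
        (hat g₂ (smulChar (-t) ψ) * hat g₃ (smulChar (-r) ψ)))‖ := norm_sum_le _ _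
    _ ≤ ∑ ψ : AddChar V ℂ, m ^ 2 * (‖hat g₃ (smulChar (-r) ψ)‖ ^ 2 + ‖hat g₄ ψ‖ ^ 2) / 2 := by
        refine sum_le_sum fun ψ _ => ?_
        simp only [norm_mul]
        have a := h₁ (smulChar (-s) ψ)
        have b := h₂ (smulChar (-t) ψ)
        have hab := mul_le_mul a b (norm_nonneg _) hm
        set A := ‖hat g₁ (smulChar (-s) ψ)‖
        set B := ‖hat g₂ (smulChar (-t) ψ)‖
        set C := ‖hat g₃ (smulChar (-r) ψ)‖
        set D := ‖hat g₄ ψ‖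
        have hC : 0 ≤ C := norm_nonneg _
        have hD : 0 ≤ D := norm_nonneg _
        have h3 := mul_le_mul_of_nonneg_right hab (mul_nonneg hC hD)
        nlinarith [mul_nonneg (sq_nonneg m) (sq_nonneg (C - D))]
    _ = _ := by
        rw [← sum_div, ← mul_sum, sum_add_distrib, hb, sum_normSq_hat]

/-- The last argument is uniform and independent of the other three, so its mean zero factor kills
the product. -/
lemma expect_mul_eq_zero_of_notMem {a b c d : ι → F} (hd : d ∉ Submodule.span F {a, b, c})
    (g₁ g₂ g₃ : V → ℝ) {g₄ : V → ℝ} (h₄ : 𝔼 x, g₄ x = 0) :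
    𝔼 v : ι → V, g₁ (dot a v) * g₂ (dot b v) * g₃ (dot c v) * g₄ (dot d v) = 0 := by
  rw [expect_resample hd fun x y z w => g₁ x * g₂ y * g₃ z * g₄ w]
  simp_rw [← mul_expect, h₄, mul_zero]
  simp

lemma expect_sq_mul_sq {a b : ι → F} (ha : a ≠ 0) (hb : b ∉ Submodule.span F {a})
    (g₁ g₂ : V → ℝ) :
    𝔼 v : ι → V, g₁ (dot a v) ^ 2 * g₂ (dot b v) ^ 2 = (𝔼 x, g₁ x ^ 2) * 𝔼 x, g₂ x ^ 2 := by
  rw [expect_dot_two ha hb fun x y => g₁ x ^ 2 * g₂ y ^ 2, Fintype.expect_mul_expect]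

/-- The product is split as (g₁g₂)(g₃g₄) and bounded by half the sum of squares; within each pair
the arguments are independent. -/
lemma abs_expect_mul_four_le_of_pairs {a b c d : ι → F} (ha : a ≠ 0)
    (hb : b ∉ Submodule.span F {a}) (hc : c ≠ 0) (hd : d ∉ Submodule.span F {c})
    (g₁ g₂ g₃ g₄ : V → ℝ) :
    |𝔼 v : ι → V, g₁ (dot a v) * g₂ (dot b v) * g₃ (dot c v) * g₄ (dot d v)| ≤
      ((𝔼 x, g₁ x ^ 2) * (𝔼 x, g₂ x ^ 2) + (𝔼 x, g₃ x ^ 2) * 𝔼 x, g₄ x ^ 2) / 2 := by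
  rw [← expect_sq_mul_sq ha hb, ← expect_sq_mul_sq hc hd, ← expect_add_distrib, expect_div]
  refine (abs_expect_le _ _).trans (expect_le_expect fun v _ => ?_)
  rw [abs_le]
  constructor
  · nlinarith [sq_nonneg (g₁ (dot a v) * g₂ (dot b v) + g₃ (dot c v) * g₄ (dot d v))]
  · nlinarith [sq_nonneg (g₁ (dot a v) * g₂ (dot b v) - g₃ (dot c v) * g₄ (dot d v))]

lemma span_pair_le_of_mem {a b c d : ι → F} (hc : c ≠ 0) (hd : d ∉ Submodule.span F {c})
    (hcs : c ∈ Submodule.span F {a, b}) (hds : d ∈ Submodule.span F {a, b}) :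
    Submodule.span F {a, b} ≤ Submodule.span F {c, d} := by
  classical
  have hle : Submodule.span F {c, d} ≤ Submodule.span F {a, b} := by
    rw [Submodule.span_le]
    rintro x (rfl | rfl) <;> assumption
  have h1 : Module.finrank F (Submodule.span F ({a, b} : Set (ι → F))) ≤ 2 := by
    have := finrank_span_finset_le_card (R := F) ({a, b} : Finset (ι → F))
    rw [Set.finrank, coe_pair] at this
    exact this.trans Finset.card_le_two
  have hli : LinearIndependent F ![c, d] := by
    rw [LinearIndependent.pair_iff' hc]
    intro s hs
    exact hd (Submodule.mem_span_singleton.2 ⟨s, hs⟩)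
  have h2 : Module.finrank F (Submodule.span F ({c, d} : Set (ι → F))) = 2 := by
    have := finrank_span_eq_card hli
    have hr : Set.range ![c, d] = {c, d} := by
      simp [Matrix.range_cons, Matrix.range_empty, Set.pair_comm]
    rwa [hr, Fintype.card_fin] at this
  exact (Submodule.eq_of_le_of_finrank_le hle (by omega)).ge

-- Three cases by linear dependence. If `c` or `d` is outside the span of the other three vectors,
-- the moment vanishes. If all four span a plane, the pairwise bound applies. Otherwise `a`, `b`,
-- `c` are independent and `d` is a combination with non-zero coefficient at `c`, so the Fourier
-- bound applies. The conditions are kept in the bound so that it can be summed by counting vectors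
-- in spans.
open Classical in
lemma abs_expect_mul_four_le_of_ne {a b c d : ι → F} (ha : a ≠ 0)
    (hb : b ∉ Submodule.span F {a}) (hc : c ≠ 0) (hd : d ∉ Submodule.span F {c})
    {g₁ g₂ g₃ g₄ : V → ℝ} {m : ℝ} (h₁ : ∀ ψ, ‖hat g₁ ψ‖ ≤ m) (h₂ : ∀ ψ, ‖hat g₂ ψ‖ ≤ m)
    (h₃ : 𝔼 x, g₃ x = 0) (h₄ : 𝔼 x, g₄ x = 0) :
    |𝔼 v : ι → V, g₁ (dot a v) * g₂ (dot b v) * g₃ (dot c v) * g₄ (dot d v)| ≤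
      ((if c ∈ Submodule.span F {a, b} ∧ d ∈ Submodule.span F {a, b} then
          (𝔼 x, g₁ x ^ 2) * (𝔼 x, g₂ x ^ 2) else 0) +
        (if a ∈ Submodule.span F {c, d} ∧ b ∈ Submodule.span F {c, d} then
          (𝔼 x, g₃ x ^ 2) * (𝔼 x, g₄ x ^ 2) else 0) +
        m ^ 2 * ((if d ∈ Submodule.span F {a, b, c} then 𝔼 x, g₃ x ^ 2 else 0) +
          (if c ∈ Submodule.span F {a, b, d} then 𝔼 x, g₄ x ^ 2 else 0))) / 2 := by
  have hw : ∀ g : V → ℝ, 0 ≤ 𝔼 x, g x ^ 2 := fun g => expect_nonneg fun _ _ => sq_nonneg _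
  have w₁ := hw g₁
  have w₂ := hw g₂
  have w₃ := hw g₃
  have w₄ := hw g₄
  have hnn : ∀ (P : Prop) [Decidable P] (x : ℝ), 0 ≤ x → 0 ≤ if P then x else 0 := by
    intro P _ x hx; split_ifs <;> simp [hx]
  have n₁ := hnn (c ∈ Submodule.span F {a, b} ∧ d ∈ Submodule.span F {a, b}) _ (mul_nonneg w₁ w₂)
  have n₂ := hnn (a ∈ Submodule.span F {c, d} ∧ b ∈ Submodule.span F {c, d}) _ (mul_nonneg w₃ w₄)
  have n₃ := hnn (d ∈ Submodule.span F {a, b, c}) _ w₃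
  have n₄ := hnn (c ∈ Submodule.span F {a, b, d}) _ w₄
  have hm2 := sq_nonneg m
  have htriv := mul_nonneg hm2 (add_nonneg n₃ n₄)
  by_cases hd3 : d ∈ Submodule.span F {a, b, c}
  swap
  · rw [expect_mul_eq_zero_of_notMem hd3 _ _ _ h₄, abs_zero]
    linarith
  by_cases hc3 : c ∈ Submodule.span F {a, b, d}
  swap
  · have := expect_mul_eq_zero_of_notMem hc3 g₁ g₂ g₄ h₃
    have e : 𝔼 v : ι → V, g₁ (dot a v) * g₂ (dot b v) * g₃ (dot c v) * g₄ (dot d v) = 0 := by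
      rw [← this]
      exact expect_congr rfl fun v _ => by ring
    rw [e, abs_zero]
    linarith
  by_cases hcs : c ∈ Submodule.span F {a, b}
  · have hds : d ∈ Submodule.span F {a, b} := by
      have : Submodule.span F {a, b, c} ≤ Submodule.span F {a, b} := by
        rw [Submodule.span_le]
        rintro x (rfl | rfl | rfl)
        · exact Submodule.subset_span (by simp)
        · exact Submodule.subset_span (by simp)
        · exact hcs
      exact this hd3
    have hle := span_pair_le_of_mem hc hd hcs hds
    rw [if_pos ⟨hcs, hds⟩, if_pos ⟨hle (Submodule.subset_span (by simp)),
      hle (Submodule.subset_span (by simp))⟩]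
    have := abs_expect_mul_four_le_of_pairs ha hb hc hd g₁ g₂ g₃ g₄
    linarith
  · obtain ⟨s, t, r, hstr⟩ := Submodule.mem_span_triple.1 hd3
    -- If r were 0, then `d` would lie in the plane of `a`, `b`, and `hc3` would put `c` there as
    -- well.
    have hr : r ≠ 0 := by
      rintro rfl
      apply hcs
      have : Submodule.span F {a, b, d} ≤ Submodule.span F {a, b} := by
        rw [Submodule.span_le]
        rintro x (rfl | rfl | rfl)
        · exact Submodule.subset_span (by simp)
        · exact Submodule.subset_span (by simp)
        · exact Submodule.mem_span_pair.2 ⟨s, t, by simpa using hstr⟩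
      exact this hc3
    have e : 𝔼 v : ι → V, g₁ (dot a v) * g₂ (dot b v) * g₃ (dot c v) * g₄ (dot d v) =
        𝔼 x, 𝔼 y, 𝔼 z, g₁ x * g₂ y * g₃ z * g₄ (s • x + t • y + r • z) := by
      rw [← expect_dot_three ha hb hcs
        fun x y z => g₁ x * g₂ y * g₃ z * g₄ (s • x + t • y + r • z)]
      refine expect_congr rfl fun v _ => ?_
      rw [← hstr, add_dot, add_dot, smul_dot, smul_dot, smul_dot]
    rw [e, if_pos hd3, if_pos hc3]
    have := abs_expect_mul_four_le g₃ g₄ s t hr h₁ h₂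
    linarith

end FourthMoment

/-! ### The rank one part of a function and its fourth moment -/

section LevelOne

variable {F : Type*} [Field F] [Fintype F] {V : Type*} [AddCommGroup V] [Module F V] [Fintype V]
  {ι : Type*} [Fintype ι] [DecidableEq ι]

lemma rep_notMem_span_of_ne {p r : ℙ F (ι → F)} (h : p ≠ r) :
    r.rep ∉ Submodule.span F {p.rep} := by
  intro hr
  obtain ⟨s, hs⟩ := Submodule.mem_span_singleton.1 hr
  apply h
  rw [← p.mk_rep, ← r.mk_rep, eq_comm, Projectivization.mk_eq_mk_iff']
  exact ⟨s, hs⟩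

lemma rep_injective : Function.Injective (Projectivization.rep : ℙ F (ι → F) → ι → F) := by
  intro p r h
  by_contra hne
  exact rep_notMem_span_of_ne hne (h ▸ Submodule.mem_span_singleton_self _)

open Classical in
lemma card_rep_mem_le (K : Submodule F (ι → F)) {j : ℕ} (hK : Module.finrank F K ≤ j) :
    (#{p : ℙ F (ι → F) | p.rep ∈ K} : ℝ) ≤ (Fintype.card F : ℝ) ^ j := by
  have h1 : #{p : ℙ F (ι → F) | p.rep ∈ K} ≤ Nat.card K := by
    rw [Nat.card_eq_fintype_card, Fintype.card_subtype, ← card_image_of_injective _ rep_injective]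
    refine card_le_card fun x hx => ?_
    obtain ⟨p, hp, rfl⟩ := mem_image.1 hx
    simpa using hp
  rw [natCard_submodule] at h1
  exact_mod_cast h1.trans (Nat.pow_le_pow_right Fintype.card_pos hK)

lemma finrank_span_pair_le (a b : ι → F) :
    Module.finrank F (Submodule.span F ({a, b} : Set (ι → F))) ≤ 2 := by
  classical
  have := finrank_span_finset_le_card (R := F) ({a, b} : Finset (ι → F))
  rw [Set.finrank, coe_pair] at this
  exact this.trans Finset.card_le_two

lemma finrank_span_triple_le (a b c : ι → F) :
    Module.finrank F (Submodule.span F ({a, b, c} : Set (ι → F))) ≤ 3 := by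
  classical
  have := finrank_span_finset_le_card (R := F) ({a, b, c} : Finset (ι → F))
  rw [Set.finrank, coe_insert, coe_pair] at this
  exact this.trans Finset.card_le_three

/-- The Fourier weight of `f` on the non-trivial characters that factor through `p`. -/
def weight (f : (ι → V) → ℝ) (p : ℙ F (ι → F)) : ℝ := 𝔼 z, dev f p.rep z ^ 2

/-- The Fourier weight of `f` on the characters of rank one. -/
def levelWeight (F : Type*) [Field F] [Fintype F] [Module F V] (f : (ι → V) → ℝ) : ℝ :=
  ∑ p : ℙ F (ι → F), weight f p

/-- The component of the rank one part of `f` that factors through `p`. -/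
def comp (f : (ι → V) → ℝ) (p : ℙ F (ι → F)) (v : ι → V) : ℝ := dev f p.rep (dot p.rep v)

lemma weight_nonneg (f : (ι → V) → ℝ) (p : ℙ F (ι → F)) : 0 ≤ weight f p :=
  expect_nonneg fun _ _ => sq_nonneg _

lemma levelWeight_nonneg (f : (ι → V) → ℝ) : 0 ≤ levelWeight F f :=
  sum_nonneg fun _ _ => weight_nonneg _ _

/-- Distinct projective points give independent combinations, and both deviations have mean zero. -/
lemma expect_comp_mul_comp (f : (ι → V) → ℝ) {p r : ℙ F (ι → F)} (h : p ≠ r) :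
    𝔼 v, comp f p v * comp f r v = 0 := by
  simp only [comp]
  rw [expect_dot_two p.rep_nonzero (rep_notMem_span_of_ne h)
    fun x y => dev f p.rep x * dev f r.rep y]
  simp [← mul_expect, expect_dev]

lemma expect_comp_sq (f : (ι → V) → ℝ) (p : ℙ F (ι → F)) :
    𝔼 v, comp f p v ^ 2 = weight f p := by
  simp only [comp]
  exact expect_dot p.rep_nonzero fun x => dev f p.rep x ^ 2

lemma expect_mul_sum_comp (f : (ι → V) → ℝ) :
    𝔼 v, f v * ∑ p : ℙ F (ι → F), comp f p v = levelWeight F f := by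
  simp_rw [mul_sum, expect_sum_comm]
  exact sum_congr rfl fun p _ => expect_mul_dev f p.rep

lemma expect_sum_comp_sq (f : (ι → V) → ℝ) :
    𝔼 v, (∑ p : ℙ F (ι → F), comp f p v) ^ 2 = levelWeight F f := by
  classical
  simp_rw [sq, sum_mul_sum, expect_sum_comm]
  refine sum_congr rfl fun p _ => ?_
  rw [sum_eq_single p (fun r _ h => expect_comp_mul_comp f h.symm) (by simp)]
  simp_rw [← sq]
  exact expect_comp_sq f p

lemma sq_expect_mul_le {α : Type*} [Fintype α] (f g : α → ℝ) :
    (𝔼 a, f a * g a) ^ 2 ≤ (𝔼 a, f a ^ 2) * 𝔼 a, g a ^ 2 := by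
  rcases isEmpty_or_nonempty α with h | h
  · simp
  simp_rw [Fintype.expect_eq_sum_div_card, div_pow, div_mul_div_comm, ← sq]
  gcongr
  exact sum_mul_sq_le_sq_mul_sq _ _ _

/-- Bessel's inequality for the rank one part X, via Cauchy-Schwarz and E[fX] = E[X²]. -/
lemma levelWeight_le (f : (ι → V) → ℝ) : levelWeight F f ≤ 𝔼 v, f v ^ 2 := by
  have h := sq_expect_mul_le f fun v => ∑ p : ℙ F (ι → F), comp f p v
  rw [expect_mul_sum_comp, expect_sum_comp_sq, sq] at h
  rcases (levelWeight_nonneg (F := F) f).eq_or_lt with h0 | h0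
  · rw [← h0]
    exact expect_nonneg fun _ _ => sq_nonneg _
  · exact le_of_mul_le_mul_right h h0

/-- Bound for the diagonal part of the fourth moment. -/
lemma expect_sum_sq_sq_le (f : (ι → V) → ℝ) {η : ℝ}
    (hη : ∀ (p : ℙ F (ι → F)) (z : V), |dev f p.rep z| ≤ η) :
    𝔼 v, (∑ p : ℙ F (ι → F), comp f p v ^ 2) ^ 2 ≤
      η ^ 2 * levelWeight F f + levelWeight F f ^ 2 := by
  classical
  simp_rw [sq (∑ p : ℙ F (ι → F), comp f p _ ^ 2), sum_mul_sum, expect_sum_comm]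
  have h : ∀ p r : ℙ F (ι → F), 𝔼 v, comp f p v ^ 2 * comp f r v ^ 2 ≤
      (if p = r then η ^ 2 * weight f p else 0) + weight f p * weight f r := by
    intro p r
    have w := mul_nonneg (weight_nonneg f p) (weight_nonneg f r)
    by_cases hpr : p = r
    · subst hpr
      rw [if_pos rfl, ← expect_comp_sq, mul_expect]
      refine le_add_of_le_of_nonneg (expect_le_expect fun v _ => ?_) (mul_self_nonneg _)
      refine mul_le_mul_of_nonneg_right ?_ (sq_nonneg _)
      rw [← sq_abs]
      exact pow_le_pow_left₀ (abs_nonneg _) (hη _ _) 2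
    · rw [if_neg hpr, zero_add]
      exact (expect_sq_mul_sq p.rep_nonzero (rep_notMem_span_of_ne hpr) _ _).le
  refine (sum_le_sum fun p _ => sum_le_sum fun r _ => h p r).trans (le_of_eq ?_)
  simp [sum_add_distrib, levelWeight, ← mul_sum, ← sum_mul, sq]

open Classical in
/-- Bound for the off-diagonal part of the fourth moment. -/
lemma expect_offDiag_sq_le (f : (ι → V) → ℝ) {m : ℝ}
    (hm : ∀ (p : ℙ F (ι → F)) (ψ : AddChar V ℂ), ‖hat (dev f p.rep) ψ‖ ≤ m) :
    𝔼 v, (∑ x ∈ (univ : Finset (ℙ F (ι → F))).offDiag, comp f x.1 v * comp f x.2 v) ^ 2 ≤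
      (Fintype.card F : ℝ) ^ 4 * levelWeight F f ^ 2 +
        (Fintype.card F : ℝ) ^ 3 * (Fintype.card (ℙ F (ι → F)) * m) ^ 2 * levelWeight F f := by
  set D := (univ : Finset (ℙ F (ι → F))).offDiag
  set q : ℝ := (Fintype.card F : ℝ)
  set W := levelWeight F f
  set N : ℝ := (Fintype.card (ℙ F (ι → F)) : ℝ)
  have hW : 0 ≤ W := levelWeight_nonneg f
  have hw := weight_nonneg (F := F) f
  have hww : ∀ p r : ℙ F (ι → F), 0 ≤ weight f p * weight f r := fun p r => mul_nonneg (hw p) (hw r)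
  have hq : 0 ≤ q := Nat.cast_nonneg _
  have hnn : ∀ (P : Prop) [Decidable P] (x : ℝ), 0 ≤ x → 0 ≤ if P then x else 0 := by
    intro P _ x hx; split_ifs <;> simp [hx]
  let T₁ : (ℙ F (ι → F)) × (ℙ F (ι → F)) → (ℙ F (ι → F)) × (ℙ F (ι → F)) → ℝ := fun x y =>
    if y.1.rep ∈ Submodule.span F {x.1.rep, x.2.rep} ∧
      y.2.rep ∈ Submodule.span F {x.1.rep, x.2.rep} then weight f x.1 * weight f x.2 else 0
  let T₃ : (ℙ F (ι → F)) × (ℙ F (ι → F)) → (ℙ F (ι → F)) → (ℙ F (ι → F)) → ℝ := fun x r s =>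
    if s.rep ∈ Submodule.span F {x.1.rep, x.2.rep, r.rep} then weight f r else 0
  have hoff : ∀ g : (ℙ F (ι → F)) × (ℙ F (ι → F)) → ℝ, (∀ y, 0 ≤ g y) →
      ∑ y ∈ D, g y ≤ ∑ r, ∑ s, g (r, s) := by
    intro g hg
    rw [← sum_product', univ_product_univ]
    exact sum_le_sum_of_subset_of_nonneg (subset_univ _) fun y _ _ => hg y
  have hpt : ∀ x ∈ D, ∀ y ∈ D, 𝔼 v, comp f x.1 v * comp f x.2 v * (comp f y.1 v * comp f y.2 v) ≤
      (T₁ x y + T₁ y x + m ^ 2 * (T₃ x y.1 y.2 + T₃ x y.2 y.1)) / 2 := by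
    intro x hx y hy
    have hx' : x.1 ≠ x.2 := (mem_offDiag.1 hx).2.2
    have hy' : y.1 ≠ y.2 := (mem_offDiag.1 hy).2.2
    have := abs_expect_mul_four_le_of_ne x.1.rep_nonzero (rep_notMem_span_of_ne hx')
      y.1.rep_nonzero (rep_notMem_span_of_ne hy') (hm x.1) (hm x.2)
      (expect_dev f y.1.rep) (expect_dev f y.2.rep)
    refine le_trans (le_of_eq ?_) ((le_abs_self _).trans this)
    exact expect_congr rfl fun v _ => by simp only [comp]; ring
  -- For a fixed pair x, both points of y lie in a plane, which leaves at most q² choices for each.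
  have hS₁ : ∑ x ∈ D, ∑ y ∈ D, T₁ x y ≤ q ^ 4 * W ^ 2 := by
    have hx : ∀ x ∈ D, ∑ y ∈ D, T₁ x y ≤ q ^ 4 * (weight f x.1 * weight f x.2) := by
      intro x _
      refine (hoff _ fun y => hnn _ _ (hww _ _)).trans ?_
      have hc := card_rep_mem_le _ (finrank_span_pair_le x.1.rep x.2.rep)
      set K := Submodule.span F ({x.1.rep, x.2.rep} : Set (ι → F))
      have e : ∑ r, ∑ s, T₁ x (r, s) =
          (#{p : ℙ F (ι → F) | p.rep ∈ K} : ℝ) * (#{p : ℙ F (ι → F) | p.rep ∈ K} : ℝ) *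
            (weight f x.1 * weight f x.2) := by
        have hT : ∀ r s, T₁ x (r, s) = (if r.rep ∈ K then 1 else 0) *
            ((if s.rep ∈ K then 1 else 0) * (weight f x.1 * weight f x.2)) := by
          intro r s
          simp only [T₁, ite_and]
          change (if r.rep ∈ K then if s.rep ∈ K then _ else 0 else 0) = _
          split_ifs <;> simp
        simp_rw [hT, ← mul_sum, ← sum_mul, sum_boole]
        ring
      rw [e]
      refine mul_le_mul_of_nonneg_right ?_ (hww _ _)
      calc _ ≤ q ^ 2 * q ^ 2 := mul_le_mul hc hc (Nat.cast_nonneg _) (by positivity)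
        _ = q ^ 4 := by ring
    refine (sum_le_sum hx).trans ?_
    rw [← mul_sum]
    refine mul_le_mul_of_nonneg_left ?_ (by positivity)
    refine (hoff _ fun y => hww _ _).trans (le_of_eq ?_)
    simp only [W, levelWeight, sq, sum_mul_sum]
  have hS₂ : ∑ x ∈ D, ∑ y ∈ D, T₁ y x ≤ q ^ 4 * W ^ 2 := by
    rw [sum_comm]; exact hS₁
  have hD : (#D : ℝ) ≤ N ^ 2 := by
    have : #D ≤ Fintype.card (ℙ F (ι → F)) ^ 2 := by
      rw [sq, ← Fintype.card_prod]
      exact card_le_univ _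
    calc (#D : ℝ) ≤ ((Fintype.card (ℙ F (ι → F)) ^ 2 : ℕ) : ℝ) := Nat.cast_le.2 this
      _ = N ^ 2 := by push_cast; rfl
  -- Here s ranges over at most q³ points of a three-dimensional span. No weight is attached to x,
  -- whence the factor N² on summing over x; the smallness of `m` has to absorb it.
  have hin : ∀ x, ∑ r, ∑ s, T₃ x r s ≤ q ^ 3 * W := by
    intro x
    simp only [T₃, W, levelWeight, mul_sum]
    refine sum_le_sum fun r _ => ?_
    rw [← sum_filter, sum_const, nsmul_eq_mul]
    exact mul_le_mul_of_nonneg_right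
      (card_rep_mem_le _ (finrank_span_triple_le x.1.rep x.2.rep r.rep)) (hw r)
  have hsum : ∀ g : (ℙ F (ι → F)) × (ℙ F (ι → F)) → (ℙ F (ι → F)) × (ℙ F (ι → F)) → ℝ,
      (∀ x, ∑ y ∈ D, g x y ≤ q ^ 3 * W) → ∑ x ∈ D, ∑ y ∈ D, g x y ≤ N ^ 2 * (q ^ 3 * W) := by
    intro g hg
    refine (sum_le_sum fun x _ => hg x).trans ?_
    rw [sum_const, nsmul_eq_mul]
    exact mul_le_mul_of_nonneg_right hD (by positivity)
  have hS₃ : ∑ x ∈ D, ∑ y ∈ D, T₃ x y.1 y.2 ≤ N ^ 2 * (q ^ 3 * W) :=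
    hsum (fun x y => T₃ x y.1 y.2) fun x =>
      (hoff (fun y => T₃ x y.1 y.2) fun y => hnn _ _ (hw _)).trans (hin x)
  have hS₄ : ∑ x ∈ D, ∑ y ∈ D, T₃ x y.2 y.1 ≤ N ^ 2 * (q ^ 3 * W) :=
    hsum (fun x y => T₃ x y.2 y.1) fun x =>
      (hoff (fun y => T₃ x y.2 y.1) fun y => hnn _ _ (hw _)).trans (by
        rw [sum_comm]; exact hin x)
  have hexp : 𝔼 v, (∑ x ∈ D, comp f x.1 v * comp f x.2 v) ^ 2 =
      ∑ x ∈ D, ∑ y ∈ D, 𝔼 v, comp f x.1 v * comp f x.2 v * (comp f y.1 v * comp f y.2 v) := by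
    simp_rw [sq, sum_mul_sum, expect_sum_comm]
  rw [hexp]
  refine (sum_le_sum fun x hx => sum_le_sum fun y hy => hpt x hx y hy).trans ?_
  simp_rw [← sum_div, sum_add_distrib, ← mul_sum, sum_add_distrib]
  have := mul_le_mul_of_nonneg_left (add_le_add hS₃ hS₄) (sq_nonneg m)
  linarith

/-- A `0/1` valued function whose rank one components are small and have small Fourier
coefficients has small rank one weight. -/
lemma levelWeight_sq_le {f : (ι → V) → ℝ} (hf : ∀ v, f v ^ 2 = f v) {η m : ℝ}
    (hη : ∀ (p : ℙ F (ι → F)) (z : V), |dev f p.rep z| ≤ η)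
    (hm : ∀ (p : ℙ F (ι → F)) (ψ : AddChar V ℂ), ‖hat (dev f p.rep) ψ‖ ≤ m) :
    levelWeight F f ^ 2 ≤ (𝔼 v, f v) *
      (√((𝔼 v, f v) * (η ^ 2 * levelWeight F f + levelWeight F f ^ 2)) +
        √((𝔼 v, f v) * ((Fintype.card F : ℝ) ^ 4 * levelWeight F f ^ 2 +
        (Fintype.card F : ℝ) ^ 3 * (Fintype.card (ℙ F (ι → F)) * m) ^ 2 * levelWeight F f))) := by
  classical
  set M := 𝔼 v, f v
  have hM2 : 𝔼 v, f v ^ 2 = M := by simp_rw [hf]; rfl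
  have hM : 0 ≤ M := by rw [← hM2]; exact expect_nonneg fun _ _ => sq_nonneg _
  set X : (ι → V) → ℝ := fun v => ∑ p : ℙ F (ι → F), comp f p v
  set Y : (ι → V) → ℝ := fun v => ∑ p : ℙ F (ι → F), comp f p v ^ 2
  set Z : (ι → V) → ℝ := fun v =>
    ∑ x ∈ (univ : Finset (ℙ F (ι → F))).offDiag, comp f x.1 v * comp f x.2 v
  have hX : ∀ v, X v ^ 2 = Y v + Z v := by
    intro v
    simp only [X, Y, Z, sq, sum_mul_sum]
    rw [← sum_product', ← diag_union_offDiag, sum_union (disjoint_diag_offDiag _), sum_diag]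
  -- Cauchy-Schwarz for f and fX; as f² = f, the factor f survives next to X².
  have h1 : levelWeight F f ^ 2 ≤ M * 𝔼 v, f v * X v ^ 2 := by
    have := sq_expect_mul_le f fun v => f v * X v
    have e1 : ∀ v, f v * (f v * X v) = f v * X v := fun v => by rw [← mul_assoc, ← sq, hf]
    have e2 : ∀ v, (f v * X v) ^ 2 = f v * X v ^ 2 := fun v => by rw [mul_pow, hf]
    simp_rw [e1, e2] at this
    rwa [expect_mul_sum_comp, hM2] at this
  have h2 : 𝔼 v, f v * Y v ≤ √(M * (η ^ 2 * levelWeight F f + levelWeight F f ^ 2)) := by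
    apply Real.le_sqrt_of_sq_le
    refine (sq_expect_mul_le f Y).trans ?_
    rw [hM2]
    exact mul_le_mul_of_nonneg_left (expect_sum_sq_sq_le f hη) hM
  have h3 : 𝔼 v, f v * Z v ≤ √(M * ((Fintype.card F : ℝ) ^ 4 * levelWeight F f ^ 2 +
        (Fintype.card F : ℝ) ^ 3 * (Fintype.card (ℙ F (ι → F)) * m) ^ 2 * levelWeight F f)) := by
    apply Real.le_sqrt_of_sq_le
    refine (sq_expect_mul_le f Z).trans ?_
    rw [hM2]
    exact mul_le_mul_of_nonneg_left (expect_offDiag_sq_le f hm) hM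
  refine h1.trans (mul_le_mul_of_nonneg_left ?_ hM)
  simp_rw [hX, mul_add, expect_add_distrib]
  simp only [mul_add] at h2 h3
  exact add_le_add h2 h3

end LevelOne

/-! ### Frames of flats and their symmetries -/

section Frames

variable {F : Type*} [Field F] [Fintype F] {V : Type*} [AddCommGroup V] [Module F V] [Fintype V]
  {ℓ : ℕ}

instance : Fintype (AffineSubspace F V) := Fintype.ofFinite _

/-- The affine subspace through `v 0` spanned by the directions `v 1, …, v ℓ`. -/
def flatOf (F : Type*) [Field F] [Module F V] (v : Fin (ℓ + 1) → V) : AffineSubspace F V :=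
  AffineSubspace.mk' (v 0) (Submodule.span F (Set.range (Fin.tail v)))

open Classical in
/-- The frames of the flats in `S`: a base point and a basis of the direction. -/
def frames (ℓ : ℕ) (S : Set (AffineSubspace F V)) : Finset (Fin (ℓ + 1) → V) :=
  {v | LinearIndependent F (Fin.tail v) ∧ flatOf F v ∈ S}

lemma mem_frames {S : Set (AffineSubspace F V)} {v : Fin (ℓ + 1) → V} :
    v ∈ frames ℓ S ↔ LinearIndependent F (Fin.tail v) ∧ flatOf F v ∈ S := by
  simp [frames]

lemma linearIndependent_iff_dot {ι : Type*} [Fintype ι] {u : ι → V} :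
    LinearIndependent F u ↔ ∀ a : ι → F, dot a u = 0 → a = 0 := by
  rw [Fintype.linearIndependent_iff]
  simp only [funext_iff]
  rfl

lemma mem_span_range_iff_dot {ι : Type*} [Fintype ι] {u : ι → V} {x : V} :
    x ∈ Submodule.span F (Set.range u) ↔ ∃ a : ι → F, dot a u = x :=
  Submodule.mem_span_range_iff_exists_fun F

lemma dot_eq_tail (c : Fin (ℓ + 1) → F) (v : Fin (ℓ + 1) → V) :
    dot c v = c 0 • v 0 + dot (Fin.tail c) (Fin.tail v) := by
  simp [dot, Fin.sum_univ_succ, Fin.tail]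

lemma mem_flatOf {v : Fin (ℓ + 1) → V} {x : V} :
    x ∈ flatOf F v ↔ x - v 0 ∈ Submodule.span F (Set.range (Fin.tail v)) := by
  rw [flatOf, AffineSubspace.mem_mk', vsub_eq_sub]

lemma direction_flatOf (v : Fin (ℓ + 1) → V) :
    (flatOf F v).direction = Submodule.span F (Set.range (Fin.tail v)) :=
  AffineSubspace.direction_mk' _ _

lemma flatOf_mem_flats {v : Fin (ℓ + 1) → V} (hv : LinearIndependent F (Fin.tail v)) :
    flatOf F v ∈ flats F V ℓ := by
  refine ⟨⟨v 0, AffineSubspace.self_mem_mk' _ _⟩, ?_⟩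
  rw [direction_flatOf, finrank_span_eq_card hv, Fintype.card_fin]

lemma flatOf_eq {v : Fin (ℓ + 1) → V} (hv : LinearIndependent F (Fin.tail v))
    {A : AffineSubspace F V} (hA : A ∈ flats F V ℓ) (h0 : v 0 ∈ A)
    (h : ∀ i, Fin.tail v i ∈ A.direction) : flatOf F v = A := by
  have hle : Submodule.span F (Set.range (Fin.tail v)) ≤ A.direction := by
    rw [Submodule.span_le]
    rintro _ ⟨i, rfl⟩
    exact h i
  have he := Submodule.eq_of_le_of_finrank_le hle (by
    rw [finrank_span_eq_card hv, hA.2, Fintype.card_fin])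
  rw [flatOf, he, AffineSubspace.mk'_eq h0]

lemma tail_mem_direction (v : Fin (ℓ + 1) → V) (i : Fin ℓ) :
    Fin.tail v i ∈ (flatOf F v).direction := by
  rw [direction_flatOf]
  exact Submodule.subset_span ⟨i, rfl⟩

lemma zero_mem_flatOf (v : Fin (ℓ + 1) → V) : v 0 ∈ flatOf F v :=
  AffineSubspace.self_mem_mk' _ _

open Classical in
/-- The number of frames of `ℓ`-flats inside an `m`-flat. -/
def frameCount (F : Type*) [Field F] [Fintype F] (m ℓ : ℕ) : ℕ :=
  #{x : (Fin m → F) × (Fin ℓ → Fin m → F) | LinearIndependent F x.2}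

lemma flatOf_le {v : Fin (ℓ + 1) → V} {B : AffineSubspace F V} (h0 : v 0 ∈ B)
    (h : ∀ i : Fin ℓ, v i.succ ∈ B.direction) : flatOf F v ≤ B := by
  have hle : Submodule.span F (Set.range (Fin.tail v)) ≤ B.direction := by
    rw [Submodule.span_le]
    rintro _ ⟨i, rfl⟩
    exact h i
  intro y hy
  have h1 := AffineSubspace.vadd_mem_of_mem_direction (hle (mem_flatOf.1 hy)) h0
  simpa using h1

/-- Coordinates on the flat, from a point of it and a basis of its direction, make the count depend
on the dimensions only. -/
lemma card_frames_flatsIn {m : ℕ} {B : AffineSubspace F V} (hB : B ∈ flats F V m) :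
    #(frames ℓ (flatsIn ℓ B)) = frameCount F m ℓ := by
  classical
  obtain ⟨⟨p, hp⟩, hfr⟩ := hB
  have hfr' : Module.finrank F (Fin m → F) = Module.finrank F B.direction := by simp [hfr]
  let e : (Fin m → F) ≃ₗ[F] B.direction := LinearEquiv.ofFinrankEq _ _ hfr'
  have hsub : Function.Injective (B.direction.subtype) := Subtype.val_injective
  have hli : ∀ s : Fin ℓ → Fin m → F, LinearIndependent F s →
      LinearIndependent F (fun i => (e (s i) : V)) := by
    intro s hs
    have h1 := hs.map' e.toLinearMap e.ker
    exact h1.map' B.direction.subtype (LinearMap.ker_eq_bot.2 hsub)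
  symm
  refine card_bij (fun x _ => Fin.cons ((e x.1 : V) + p) (fun i => (e (x.2 i) : V))) ?_ ?_ ?_
  · intro x hx
    have hx' : LinearIndependent F x.2 := by simpa using hx
    rw [mem_frames]
    have h1 : LinearIndependent F
        (Fin.tail (Fin.cons ((e x.1 : V) + p) (fun i => (e (x.2 i) : V)) : Fin (ℓ + 1) → V)) := by
      rw [Fin.tail_cons]
      exact hli _ hx'
    refine ⟨h1, flatOf_mem_flats h1, flatOf_le ?_ ?_⟩
    · rw [Fin.cons_zero]
      exact AffineSubspace.vadd_mem_of_mem_direction (e x.1).2 hp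
    · intro i
      rw [Fin.cons_succ]
      exact (e (x.2 i)).2
  · rintro ⟨a, b⟩ _ ⟨a', b'⟩ _ h
    obtain ⟨h1, h2⟩ := Fin.cons_inj.1 h
    have ha : a = a' := e.injective (Subtype.ext (add_right_cancel h1))
    have hb : b = b' := by
      funext i
      exact e.injective (Subtype.ext (congrFun h2 i))
    rw [ha, hb]
  · intro v hv
    rw [mem_frames] at hv
    obtain ⟨hv1, -, hv2⟩ := hv
    have h0 : v 0 - p ∈ B.direction := by
      have := AffineSubspace.vsub_mem_direction (hv2 (zero_mem_flatOf v)) hp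
      simpa using this
    have ht : ∀ i, Fin.tail v i ∈ B.direction := fun i =>
      AffineSubspace.direction_le hv2 (tail_mem_direction v i)
    refine ⟨(e.symm ⟨_, h0⟩, fun i => e.symm ⟨_, ht i⟩), ?_, ?_⟩
    · simp only [mem_filter, mem_univ, true_and]
      have h1 : LinearIndependent F (fun i => (⟨_, ht i⟩ : B.direction)) :=
        LinearIndependent.of_comp B.direction.subtype hv1
      exact h1.map' e.symm.toLinearMap e.symm.ker
    · funext i
      refine Fin.cases ?_ (fun j => ?_) i
      · simp
      · simp [Fin.tail]

lemma eq_of_le_of_mem_flats {A B : AffineSubspace F V} (hA : A ∈ flats F V ℓ)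
    (hB : B ∈ flats F V ℓ) (h : A ≤ B) : A = B :=
  AffineSubspace.eq_of_direction_eq_of_nonempty_of_le
    (Submodule.eq_of_le_of_finrank_le (AffineSubspace.direction_le h) (by rw [hA.2, hB.2])) hA.1 h

lemma flatsIn_self {A : AffineSubspace F V} (hA : A ∈ flats F V ℓ) : flatsIn ℓ A = {A} := by
  ext B
  constructor
  · rintro ⟨hB, hle⟩
    exact eq_of_le_of_mem_flats hB hA hle
  · rintro rfl
    exact ⟨hA, le_rfl⟩

lemma card_frames_singleton {A : AffineSubspace F V} (hA : A ∈ flats F V ℓ) :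
    #(frames ℓ {A}) = frameCount F ℓ ℓ := by
  rw [← flatsIn_self hA, card_frames_flatsIn hA]

-- Each flat has the same number of frames, so averages over flats and averages over frames agree.
open Classical in
lemma sum_frames {S : Set (AffineSubspace F V)} (hS : S ⊆ flats F V ℓ)
    (h : AffineSubspace F V → ℝ) :
    ∑ v ∈ frames ℓ S, h (flatOf F v) = frameCount F ℓ ℓ * ∑ A ∈ S.toFinset, h A := by
  rw [← sum_fiberwise_of_maps_to (t := S.toFinset) (g := flatOf F)
    (fun v hv => by simpa using (mem_frames.1 hv).2), mul_sum]
  refine sum_congr rfl fun A hA => ?_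
  rw [Set.mem_toFinset] at hA
  have hfil : {v ∈ frames ℓ S | flatOf F v = A} = frames ℓ {A} := by
    ext v
    simp only [mem_filter, mem_frames, Set.mem_singleton_iff]
    constructor
    · rintro ⟨⟨h1, -⟩, h3⟩
      exact ⟨h1, h3⟩
    · rintro ⟨h1, h3⟩
      exact ⟨⟨h1, h3 ▸ hA⟩, h3⟩
  rw [hfil, sum_congr rfl (g := fun _ => h A), sum_const, card_frames_singleton (hS hA),
    nsmul_eq_mul]
  intro v hv
  rw [(mem_frames.1 hv).2]

lemma card_frames {S : Set (AffineSubspace F V)} (hS : S ⊆ flats F V ℓ) :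
    (#(frames ℓ S) : ℝ) = frameCount F ℓ ℓ * S.ncard := by
  classical
  have := sum_frames hS fun _ => 1
  simpa [Set.ncard_eq_toFinset_card'] using this

/-- A density bound for flats is a density bound for frames. -/
lemma card_frames_inter_le {E S : Set (AffineSubspace F V)} (hE : E ⊆ flats F V ℓ) {ξ : ℝ}
    (h : prob E S ≤ ξ) : (#(frames ℓ (E ∩ S)) : ℝ) ≤ ξ * #(frames ℓ E) := by
  rw [card_frames hE, card_frames (Set.inter_subset_left.trans hE)]
  rcases Nat.eq_zero_or_pos E.ncard with h0 | h0
  · have : E = ∅ := (Set.ncard_eq_zero (Set.toFinite E)).1 h0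
    simp [this]
  · rw [prob, div_le_iff₀ (by exact_mod_cast h0)] at h
    calc _ ≤ (frameCount F ℓ ℓ : ℝ) * (ξ * E.ncard) :=
          mul_le_mul_of_nonneg_left h (Nat.cast_nonneg _)
      _ = _ := by ring

lemma exists_linearEquiv_apply_eq {E : Type*} [AddCommGroup E] [Module F E] [FiniteDimensional F E]
    {a b : E} (ha : a ≠ 0) (hb : b ≠ 0) : ∃ g : E ≃ₗ[F] E, g a = b := by
  obtain ⟨g, hg⟩ := Submodule.exists_linearEquiv_restrict_eq
    ((LinearEquiv.toSpanNonzeroSingleton F E a ha).symm ≪≫ₗ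
      LinearEquiv.toSpanNonzeroSingleton F E b hb)
  refine ⟨g, ?_⟩
  have h1 : (LinearEquiv.toSpanNonzeroSingleton F E a ha).symm
      ⟨a, Submodule.mem_span_singleton_self a⟩ = 1 := by
    rw [LinearEquiv.symm_apply_eq]
    ext
    simp
  rw [← hg ⟨a, Submodule.mem_span_singleton_self a⟩, LinearEquiv.trans_apply, h1]
  simp

/-- Translating the base point inside the flat. -/
lemma sum_frames_dot_eq_of_zero_ne {R : Type*} [AddCommMonoid R] (S : Set (AffineSubspace F V))
    {c c' : Fin (ℓ + 1) → F} (hc : c 0 ≠ 0) (hcc : c 0 = c' 0) (Φ : V → R) :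
    ∑ v ∈ frames ℓ S, Φ (dot c v) = ∑ v ∈ frames ℓ S, Φ (dot c' v) := by
  let π : (Fin ℓ → F) → (Fin (ℓ + 1) → V) → Fin (ℓ + 1) → V := fun b v =>
    Fin.cons (v 0 + dot b (Fin.tail v)) (Fin.tail v)
  have hπ : ∀ b, ∀ v ∈ frames ℓ S, π b v ∈ frames ℓ S := by
    intro b v hv
    rw [mem_frames] at hv ⊢
    refine ⟨by simpa [π] using hv.1, ?_⟩
    convert hv.2 using 1
    refine flatOf_eq (by simpa [π] using hv.1) (flatOf_mem_flats hv.1) ?_ ?_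
    · rw [mem_flatOf]
      simp only [π, Fin.cons_zero, add_sub_cancel_left]
      exact mem_span_range_iff_dot.2 ⟨b, rfl⟩
    · intro i
      simp only [π, Fin.tail_cons]
      exact tail_mem_direction v i
  have hinv : ∀ b v, π (-b) (π b v) = v := by
    intro b v
    have : dot (-b) (Fin.tail v) = -dot b (Fin.tail v) := by simp [dot]
    simp only [π, Fin.cons_zero, Fin.tail_cons, this, add_neg_cancel_right, Fin.cons_self_tail]
  -- Chosen so that moving the base point by `dot b` of the basis turns `dot c'` into `dot c`.
  let b : Fin ℓ → F := (c 0)⁻¹ • (Fin.tail c - Fin.tail c')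
  refine sum_nbij' (π b) (π (-b)) (fun v hv => hπ _ v hv) (fun v hv => hπ _ v hv)
    (fun v _ => hinv b v) (fun v _ => ?_) (fun v _ => ?_)
  · simpa using hinv (-b) v
  · congr 1
    rw [dot_eq_tail, dot_eq_tail]
    simp only [π, Fin.cons_zero, Fin.tail_cons, ← hcc, smul_add]
    have hb : Fin.tail c = c 0 • b + Fin.tail c' := by
      simp [b, smul_smul, mul_inv_cancel₀ hc]
    rw [hb, add_dot, smul_dot, add_assoc]

/-- Changing the basis of the direction. -/
lemma sum_frames_dot_eq_of_ne_zero {R : Type*} [AddCommMonoid R] (S : Set (AffineSubspace F V))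
    {a a' : Fin ℓ → F} (ha : a ≠ 0) (ha' : a' ≠ 0) (Φ : V → R) :
    ∑ v ∈ frames ℓ S, Φ (dot a (Fin.tail v)) = ∑ v ∈ frames ℓ S, Φ (dot a' (Fin.tail v)) := by
  -- GL acts transitively on non-zero coefficient vectors; `g` acts on frames by a change of basis,
  -- leaving the flat unchanged.
  obtain ⟨g, hg⟩ := exists_linearEquiv_apply_eq (F := F) ha' ha
  let π : ((Fin ℓ → F) ≃ₗ[F] (Fin ℓ → F)) → (Fin (ℓ + 1) → V) → Fin (ℓ + 1) → V := fun g v =>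
    Fin.cons (v 0) (fun i => dot (g (Pi.single i 1)) (Fin.tail v))
  have hdot : ∀ g v x, dot x (Fin.tail (π g v)) = dot (g x) (Fin.tail v) := by
    intro g v x
    conv_rhs => rw [pi_eq_sum_univ' x, map_sum]
    have hs : ∀ s : Finset (Fin ℓ), dot (∑ i ∈ s, g (x i • Pi.single i 1)) (Fin.tail v) =
        ∑ i ∈ s, x i • dot (g (Pi.single i 1)) (Fin.tail v) := by
      intro s
      induction s using Finset.induction_on with
      | empty => simp [zero_dot]
      | insert i s hi ih => rw [sum_insert hi, sum_insert hi, add_dot, map_smul, smul_dot, ih]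
    rw [hs]
    simp [π, dot]
  have hπ : ∀ g, ∀ v ∈ frames ℓ S, π g v ∈ frames ℓ S := by
    intro g v hv
    rw [mem_frames] at hv ⊢
    have hli : LinearIndependent F (Fin.tail (π g v)) := by
      rw [linearIndependent_iff_dot]
      intro x hx
      rw [hdot] at hx
      have := linearIndependent_iff_dot.1 hv.1 _ hx
      simpa using this
    refine ⟨hli, ?_⟩
    convert hv.2 using 1
    refine flatOf_eq hli (flatOf_mem_flats hv.1) ?_ ?_
    · simp only [π, Fin.cons_zero]
      exact zero_mem_flatOf v
    · intro i
      rw [direction_flatOf, mem_span_range_iff_dot]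
      exact ⟨g (Pi.single i 1), by simp [π]⟩
  have hinv : ∀ g v, π g.symm (π g v) = v := by
    intro g v
    have h1 : ∀ i, dot (g.symm (Pi.single i 1)) (Fin.tail (π g v)) = Fin.tail v i := by
      intro i
      rw [hdot, LinearEquiv.apply_symm_apply]
      simp [dot, Pi.single_apply]
    have h2 : π g.symm (π g v) = Fin.cons (v 0) (Fin.tail v) := by
      have h0 : π g v 0 = v 0 := by simp [π]
      have h3 : (fun i => dot (g.symm (Pi.single i 1)) (Fin.tail (π g v))) = Fin.tail v :=
        funext h1
      rw [← h3, ← h0]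
    rw [h2, Fin.cons_self_tail]
  refine sum_nbij' (π g) (π g.symm) (fun v hv => hπ _ v hv) (fun v hv => hπ _ v hv)
    (fun v _ => hinv g v) (fun v _ => ?_) (fun v _ => ?_)
  · simpa using hinv g.symm v
  · rw [hdot, hg]

end Frames

/-! ### Conditional expectations as densities at points and directions -/

section Bounds

variable {F : Type*} [Field F] [Fintype F] {V : Type*} [AddCommGroup V] [Module F V] [Fintype V]
  {ℓ : ℕ}

open Classical in
/-- The indicator function of the frames of the flats in `S`. -/
def frameInd (ℓ : ℕ) (S : Set (AffineSubspace F V)) (v : Fin (ℓ + 1) → V) : ℝ :=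
  if v ∈ frames ℓ S then 1 else 0

lemma frameInd_sq (S : Set (AffineSubspace F V)) (v : Fin (ℓ + 1) → V) :
    frameInd ℓ S v ^ 2 = frameInd ℓ S v := by
  unfold frameInd; split_ifs <;> norm_num

lemma expect_frameInd (S : Set (AffineSubspace F V)) :
    𝔼 v, frameInd ℓ S v = #(frames ℓ S) / (Fintype.card V : ℝ) ^ (ℓ + 1) := by
  rw [Fintype.expect_eq_sum_div_card]
  simp [frameInd]

lemma flats_inter_of_subset {S : Set (AffineSubspace F V)} (hS : S ⊆ flats F V ℓ) :
    flats F V ℓ ∩ S = S := Set.inter_eq_right.2 hS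

lemma card_frames_le {S : Set (AffineSubspace F V)} (hS : S ⊆ flats F V ℓ) {ξ : ℝ} (hξ : 0 ≤ ξ)
    (hμ : measure ℓ S ≤ ξ) : (#(frames ℓ S) : ℝ) ≤ ξ * (Fintype.card V : ℝ) ^ (ℓ + 1) := by
  have h := card_frames_inter_le (ℓ := ℓ) subset_rfl hμ
  rw [flats_inter_of_subset hS] at h
  refine h.trans (mul_le_mul_of_nonneg_left ?_ hξ)
  have : #(frames ℓ (flats F V ℓ)) ≤ Fintype.card (Fin (ℓ + 1) → V) := card_le_univ _
  rw [Fintype.card_fun, Fintype.card_fin] at this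
  exact_mod_cast this

lemma expect_frameInd_le {S : Set (AffineSubspace F V)} (hS : S ⊆ flats F V ℓ) {ξ : ℝ}
    (hξ : 0 ≤ ξ) (hμ : measure ℓ S ≤ ξ) : 𝔼 v, frameInd ℓ S v ≤ ξ := by
  have : (0 : ℝ) < Fintype.card V := by exact_mod_cast Fintype.card_pos
  rw [expect_frameInd, div_le_iff₀ (by positivity)]
  exact card_frames_le hS hξ hμ

/-- Averaging over the points of the flat. -/
lemma card_smul_sum_frames_dot_of_zero_ne {R : Type*} [AddCommMonoid R]
    (S : Set (AffineSubspace F V)) {c : Fin (ℓ + 1) → F} (hc : c 0 ≠ 0) (Φ : V → R) :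
    (Fintype.card F ^ ℓ) • ∑ v ∈ frames ℓ S, Φ (dot c v) =
      ∑ v ∈ frames ℓ S, ∑ a : Fin ℓ → F, Φ (c 0 • v 0 + dot a (Fin.tail v)) := by
  rw [sum_comm]
  have h : ∀ a : Fin ℓ → F, ∑ v ∈ frames ℓ S, Φ (c 0 • v 0 + dot a (Fin.tail v)) =
      ∑ v ∈ frames ℓ S, Φ (dot c v) := by
    intro a
    rw [sum_frames_dot_eq_of_zero_ne S hc (c' := Fin.cons (c 0) a) (by simp) Φ]
    refine sum_congr rfl fun v _ => ?_
    rw [dot_eq_tail]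
    simp
  simp_rw [h]
  simp

open Classical in
/-- Averaging over the non-zero vectors of the direction. -/
lemma card_smul_sum_frames_dot_of_ne_zero {R : Type*} [AddCommMonoid R]
    (S : Set (AffineSubspace F V)) {b : Fin ℓ → F} (hb : b ≠ 0) (Φ : V → R) :
    (Fintype.card F ^ ℓ - 1) • ∑ v ∈ frames ℓ S, Φ (dot b (Fin.tail v)) =
      ∑ v ∈ frames ℓ S, ∑ a ∈ univ.erase (0 : Fin ℓ → F), Φ (dot a (Fin.tail v)) := by
  rw [sum_comm, sum_congr rfl fun a ha =>
    sum_frames_dot_eq_of_ne_zero S (ne_of_mem_erase ha) hb Φ]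
  simp

lemma dot_injective {ι : Type*} [Fintype ι] {u : ι → V} (hu : LinearIndependent F u)
    {a b : ι → F} (h : dot a u = dot b u) : a = b := by
  have h1 : dot (a + (-1 : F) • b) u = 0 := by
    rw [add_dot, smul_dot, h]; simp
  have h2 := linearIndependent_iff_dot.1 hu _ h1
  rw [neg_one_smul] at h2
  exact add_neg_eq_zero.1 h2

-- Averaged over the frames of one flat, `dot c v / c 0` is uniform on the q^ℓ points of that flat,
-- so it hits a given point with frequency q^(-ℓ) if the point is on the flat, and never otherwise.
open Classical in
lemma card_frames_dot_eq_of_zero_ne (S : Set (AffineSubspace F V)) {c : Fin (ℓ + 1) → F}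
    (hc : c 0 ≠ 0) (z : V) :
    Fintype.card F ^ ℓ * #{v ∈ frames ℓ S | dot c v = z} =
      #(frames ℓ (S ∩ {A | (c 0)⁻¹ • z ∈ A})) := by
  have h := card_smul_sum_frames_dot_of_zero_ne S hc fun x => if x = z then 1 else 0
  rw [sum_boole, smul_eq_mul, Nat.cast_id] at h
  rw [h]
  have h1 : ∀ v ∈ frames ℓ S, ∑ a : Fin ℓ → F,
      (if c 0 • v 0 + dot a (Fin.tail v) = z then 1 else 0) =
      if (c 0)⁻¹ • z ∈ flatOf F v then 1 else 0 := by
    intro v hv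
    have hli := (mem_frames.1 hv).1
    have hiff : (c 0)⁻¹ • z ∈ flatOf F v ↔
        ∃ a : Fin ℓ → F, c 0 • v 0 + dot a (Fin.tail v) = z := by
      rw [mem_flatOf, mem_span_range_iff_dot]
      constructor
      · rintro ⟨a, ha⟩
        refine ⟨c 0 • a, ?_⟩
        rw [smul_dot, ha, smul_sub, smul_smul, mul_inv_cancel₀ hc, one_smul]
        abel
      · rintro ⟨a, rfl⟩
        refine ⟨(c 0)⁻¹ • a, ?_⟩
        rw [smul_dot, smul_add, smul_smul, inv_mul_cancel₀ hc, one_smul]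
        abel
    split_ifs with h2
    · obtain ⟨a, ha⟩ := hiff.1 h2
      rw [sum_eq_single a]
      · rw [if_pos ha]
      · intro b _ hba
        rw [if_neg]
        intro hb
        exact hba (dot_injective hli (add_left_cancel (hb.trans ha.symm)))
      · simp
    · exact sum_eq_zero fun a _ => if_neg fun h3 => h2 (hiff.2 ⟨a, h3⟩)
  rw [sum_congr rfl h1, sum_boole, Nat.cast_id]
  congr 1
  ext v
  simp only [mem_filter, mem_frames, Set.mem_inter_iff, Set.mem_ofPred_eq, and_assoc]

-- Averaged over the frames of one flat, `dot b` of the basis is uniform on the q^ℓ - 1 non-zero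
-- vectors of the direction.
open Classical in
lemma card_frames_dot_eq_of_ne_zero (S : Set (AffineSubspace F V)) {b : Fin ℓ → F}
    (hb : b ≠ 0) {z : V} (hz : z ≠ 0) :
    (Fintype.card F ^ ℓ - 1) * #{v ∈ frames ℓ S | dot b (Fin.tail v) = z} =
      #(frames ℓ (S ∩ {A | z ∈ A.direction})) := by
  have h := card_smul_sum_frames_dot_of_ne_zero S hb fun x => if x = z then 1 else 0
  rw [sum_boole, smul_eq_mul, Nat.cast_id] at h
  rw [h]
  have h1 : ∀ v ∈ frames ℓ S, ∑ a ∈ univ.erase (0 : Fin ℓ → F),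
      (if dot a (Fin.tail v) = z then 1 else 0) =
      if z ∈ (flatOf F v).direction then 1 else 0 := by
    intro v hv
    have hli := (mem_frames.1 hv).1
    rw [direction_flatOf, mem_span_range_iff_dot]
    split_ifs with h2
    · obtain ⟨a, ha⟩ := h2
      rw [sum_eq_single a]
      · rw [if_pos ha]
      · intro b _ hba
        rw [if_neg]
        intro hb
        exact hba (dot_injective hli (hb.trans ha.symm))
      · intro h3
        exfalso
        apply h3
        rw [mem_erase]
        refine ⟨?_, mem_univ _⟩
        rintro rfl
        rw [zero_dot] at ha
        exact hz ha.symm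
    · exact sum_eq_zero fun a _ => if_neg fun h3 => h2 ⟨a, h3⟩
  rw [sum_congr rfl h1, sum_boole, Nat.cast_id]
  congr 1
  ext v
  simp only [mem_filter, mem_frames, Set.mem_inter_iff, Set.mem_ofPred_eq, and_assoc]

open Classical in
lemma condE_frameInd (S : Set (AffineSubspace F V)) (c : Fin (ℓ + 1) → F) (z : V) :
    condE (frameInd ℓ S) c z =
      #{v ∈ frames ℓ S | dot c v = z} / (Fintype.card V : ℝ) ^ ℓ := by
  have hV : (Fintype.card V : ℝ) ≠ 0 := by exact_mod_cast Fintype.card_ne_zero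
  have h : ∀ v : Fin (ℓ + 1) → V, (if dot c v = z then frameInd ℓ S v else 0) =
      if v ∈ frames ℓ S ∧ dot c v = z then 1 else 0 := by
    intro v
    unfold frameInd
    split_ifs <;> simp_all
  rw [condE, Fintype.expect_eq_sum_div_card]
  simp only [h, sum_boole]
  rw [Fintype.card_fun, Fintype.card_fin]
  have e : (univ.filter fun v => v ∈ frames ℓ S ∧ dot c v = z) =
      {v ∈ frames ℓ S | dot c v = z} := by
    ext v; simp
  rw [e]
  push_cast
  field_simp
  ring

open Classical in
lemma card_dot_eq {c : Fin (ℓ + 1) → F} (hc : c ≠ 0) (z : V) :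
    (#{v : Fin (ℓ + 1) → V | dot c v = z} : ℝ) = (Fintype.card V : ℝ) ^ ℓ := by
  have hV : (Fintype.card V : ℝ) ≠ 0 := by exact_mod_cast Fintype.card_ne_zero
  have h := expect_dot (V := V) hc fun x => if x = z then (1 : ℝ) else 0
  rw [Fintype.expect_eq_sum_div_card, Fintype.expect_eq_sum_div_card, sum_boole, sum_boole] at h
  have e : #{x : V | x = z} = 1 := card_eq_one.2 ⟨z, by ext; simp⟩
  rw [e, Fintype.card_fun, Fintype.card_fin] at h
  push_cast at h
  rw [div_eq_div_iff (pow_ne_zero _ hV) hV, one_mul, pow_succ] at h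
  exact mul_right_cancel₀ hV h

/-- The frames with `dot c v = z` are, up to a factor independent of the set of flats, the frames of
flats satisfying a point or direction condition. Comparing `S` with the set of all flats cancels the
factor. Families with dependent directions only enlarge the denominator. -/
lemma condE_frameInd_le {S : Set (AffineSubspace F V)} (hS : S ⊆ flats F V ℓ) {η : ℝ}
    (hη : 0 ≤ η) (hpt : ∀ x, measurePoint ℓ S x ≤ η) (hlin : ∀ y, measurePointLin ℓ S y ≤ η)
    (hℓ : ℓ ≠ 0) {c : Fin (ℓ + 1) → F} (hc : c ≠ 0) (z : V) : condE (frameInd ℓ S) c z ≤ η := by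
  classical
  have hV : (0 : ℝ) < Fintype.card V := by exact_mod_cast Fintype.card_pos
  have hq1 : 1 < Fintype.card F := Fintype.one_lt_card
  rw [condE_frameInd, div_le_iff₀ (by positivity), ← card_dot_eq hc z]
  have hsub : ∀ T : Set (AffineSubspace F V), (#{v ∈ frames ℓ T | dot c v = z} : ℝ) ≤
      #{v : Fin (ℓ + 1) → V | dot c v = z} := fun T => by
    exact_mod_cast card_le_card (filter_subset_filter _ (subset_univ _))
  have key : ∀ (k : ℕ) (P : Set (AffineSubspace F V)), 0 < k →
      (∀ T : Set (AffineSubspace F V), k * #{v ∈ frames ℓ T | dot c v = z} =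
        #(frames ℓ (T ∩ P))) → prob (flats F V ℓ ∩ P) S ≤ η →
      (#{v ∈ frames ℓ S | dot c v = z} : ℝ) ≤ η * #{v : Fin (ℓ + 1) → V | dot c v = z} := by
    intro k P hk hT hp
    have h1 := card_frames_inter_le Set.inter_subset_left hp
    have e : flats F V ℓ ∩ P ∩ S = S ∩ P := by
      rw [Set.inter_right_comm, flats_inter_of_subset hS]
    rw [e, ← hT, ← hT] at h1
    push_cast at h1
    have hk' : (0 : ℝ) < k := by exact_mod_cast hk
    have h2 : (#{v ∈ frames ℓ S | dot c v = z} : ℝ) ≤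
        η * #{v ∈ frames ℓ (flats F V ℓ) | dot c v = z} :=
      le_of_mul_le_mul_left (by linarith) hk'
    exact h2.trans (mul_le_mul_of_nonneg_left (hsub _) hη)
  by_cases hc0 : c 0 = 0
  · have hdot : ∀ v : Fin (ℓ + 1) → V, dot c v = dot (Fin.tail c) (Fin.tail v) := fun v => by
      rw [dot_eq_tail, hc0, zero_smul, zero_add]
    have htail : Fin.tail c ≠ 0 := by
      intro h
      apply hc
      funext i
      refine Fin.cases hc0 (fun j => ?_) i
      exact congrFun h j
    -- For z = 0 the condition is incompatible with independence of the basis, so no frame satisfies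
    -- it.
    by_cases hz : z = 0
    · have : #{v ∈ frames ℓ S | dot c v = z} = 0 := by
        rw [card_eq_zero, filter_eq_empty_iff]
        intro v hv h
        rw [hdot, hz] at h
        exact htail (linearIndependent_iff_dot.1 (mem_frames.1 hv).1 _ h)
      rw [this]
      push_cast
      positivity
    · refine key (Fintype.card F ^ ℓ - 1) {A | z ∈ A.direction} ?_ ?_ (hlin z)
      · have := Nat.one_lt_pow hℓ hq1
        omega
      · intro T
        simp only [hdot]
        exact card_frames_dot_eq_of_ne_zero T htail hz
  · exact key (Fintype.card F ^ ℓ) {A | (c 0)⁻¹ • z ∈ A} (by positivity)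
      (fun T => card_frames_dot_eq_of_zero_ne T hc0 z) (hpt _)

end Bounds

/-! ### Rank one Fourier coefficients and hyperplanes -/

section FourierBounds

variable {F : Type*} [Field F] [Fintype F] {V : Type*} [AddCommGroup V] [Module F V] [Fintype V]
  {ℓ : ℕ}

/-- The vectors whose whole line is killed by ψ form a subspace, proper because ψ is non-trivial,
hence contained in a hyperplane. -/
lemma exists_hyperplane_of_char {ψ : AddChar V ℂ} (hψ : ψ ≠ 0) :
    ∃ H : Submodule F V, Module.finrank F H = Module.finrank F V - 1 ∧
      Module.finrank F V ≠ 0 ∧ ∀ w : V, (∀ t : F, ψ (t • w) = 1) → w ∈ H := by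
  let K : Submodule F V :=
    { carrier := {w | ∀ t : F, ψ (t • w) = 1}
      zero_mem' := by simp
      add_mem' := by
        intro a b ha hb t
        rw [smul_add, AddChar.map_add_eq_mul, ha, hb, one_mul]
      smul_mem' := by
        intro s a ha t
        rw [smul_smul]
        exact ha _ }
  have hK : K < ⊤ := by
    refine lt_top_iff_ne_top.2 fun h => hψ ?_
    rw [AddChar.eq_zero_iff]
    intro w
    have hw : w ∈ K := by rw [h]; trivial
    simpa using hw 1
  obtain ⟨φ, hφ, hle⟩ := Submodule.exists_le_ker_of_lt_top K hK
  have := Module.Dual.finrank_ker_add_one_of_ne_zero hφ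
  exact ⟨LinearMap.ker φ, by omega, by omega, fun w hw => hle hw⟩

-- Such frames lie in cosets of `H`. Each coset is an affine hyperplane and carries at most
-- ξ|H|^(ℓ+1) frames of `S`; summing over all x in `V` counts every frame |H| times.
open Classical in
lemma card_frames_tail_mem_le {S : Set (AffineSubspace F V)} {ξ : ℝ} (hξ : 0 ≤ ξ)
    (hS : S ⊆ flats F V ℓ) (hhyp : PseudoRandomHyperplanes ℓ ξ S) {H : Submodule F V}
    (hH : Module.finrank F H = Module.finrank F V - 1) :
    (#{v ∈ frames ℓ S | ∀ i : Fin ℓ, v i.succ ∈ H} : ℝ) ≤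
      ξ * (Fintype.card V * (Nat.card H : ℝ) ^ ℓ) := by
  have hHpos : (0 : ℝ) < Nat.card H := by exact_mod_cast Nat.card_pos
  have hone : ∀ x : V, (#{v ∈ frames ℓ S | (∀ i : Fin ℓ, v i.succ ∈ H) ∧ v 0 - x ∈ H} : ℝ) ≤
      ξ * (Nat.card H : ℝ) ^ (ℓ + 1) := by
    intro x
    have hmem : AffineSubspace.mk' x H ∈ flats F V (Module.finrank F V - 1) :=
      ⟨AffineSubspace.mk'_nonempty _ _, by rw [AffineSubspace.direction_mk', hH]⟩
    have h1 := card_frames_inter_le (ℓ := ℓ) (E := flatsIn ℓ (AffineSubspace.mk' x H))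
      (fun A hA => hA.1) (hhyp _ hmem)
    have h2 : {v ∈ frames ℓ S | (∀ i : Fin ℓ, v i.succ ∈ H) ∧ v 0 - x ∈ H} ⊆
        frames ℓ (flatsIn ℓ (AffineSubspace.mk' x H) ∩ S) := by
      intro v hv
      obtain ⟨hv, ht, h0⟩ := mem_filter.1 hv
      obtain ⟨hli, hvS⟩ := mem_frames.1 hv
      refine mem_frames.2 ⟨hli, ⟨hS hvS, fun y hy => ?_⟩, hvS⟩
      rw [mem_flatOf] at hy
      rw [AffineSubspace.mem_mk', vsub_eq_sub]
      have hle : Submodule.span F (Set.range (Fin.tail v)) ≤ H := by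
        rw [Submodule.span_le]
        rintro _ ⟨i, rfl⟩
        exact ht i
      have := H.add_mem (hle hy) h0
      simpa using this
    have h3 : #(frames ℓ (flatsIn ℓ (AffineSubspace.mk' x H))) ≤ Nat.card H ^ (ℓ + 1) := by
      have e : Nat.card H ^ (ℓ + 1) = Fintype.card (Fin (ℓ + 1) → H) := by
        rw [Fintype.card_fun, Fintype.card_fin, Nat.card_eq_fintype_card]
      rw [e, ← card_univ]
      refine card_le_card_of_surjOn
        (fun u : Fin (ℓ + 1) → H => (Fin.cons (x + u 0) (fun i => (u i.succ : V)) :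
          Fin (ℓ + 1) → V)) ?_
      intro v hv
      obtain ⟨hli, hv⟩ := mem_frames.1 hv
      have hle : flatOf F v ≤ AffineSubspace.mk' x H := hv.2
      have h0 : v 0 - x ∈ H := by
        have := hle (zero_mem_flatOf v)
        rwa [AffineSubspace.mem_mk', vsub_eq_sub] at this
      have ht : ∀ i : Fin ℓ, v i.succ ∈ H := fun i => by
        have := AffineSubspace.direction_le hle (tail_mem_direction v i)
        rwa [AffineSubspace.direction_mk'] at this
      refine ⟨Fin.cons ⟨_, h0⟩ fun i => ⟨_, ht i⟩, by simp, ?_⟩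
      funext i
      refine Fin.cases ?_ (fun j => ?_) i
      · simp
      · simp
    have h2' : (#{v ∈ frames ℓ S | (∀ i : Fin ℓ, v i.succ ∈ H) ∧ v 0 - x ∈ H} : ℝ) ≤
        #(frames ℓ (flatsIn ℓ (AffineSubspace.mk' x H) ∩ S)) := by
      exact_mod_cast card_le_card h2
    have h3' : (#(frames ℓ (flatsIn ℓ (AffineSubspace.mk' x H))) : ℝ) ≤
        (Nat.card H : ℝ) ^ (ℓ + 1) := by exact_mod_cast h3
    exact h2'.trans (h1.trans (mul_le_mul_of_nonneg_left h3' hξ))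
  have hsum : ∑ x : V, (#{v ∈ frames ℓ S | (∀ i : Fin ℓ, v i.succ ∈ H) ∧ v 0 - x ∈ H} : ℝ) =
      #{v ∈ frames ℓ S | ∀ i : Fin ℓ, v i.succ ∈ H} * (Nat.card H : ℝ) := by
    have e : ∀ x : V, (#{v ∈ frames ℓ S | (∀ i : Fin ℓ, v i.succ ∈ H) ∧ v 0 - x ∈ H} : ℝ) =
        ∑ v ∈ frames ℓ S with ∀ i : Fin ℓ, v i.succ ∈ H, if v 0 - x ∈ H then (1 : ℝ) else 0 := by
      intro x
      rw [sum_boole, filter_filter]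
    simp_rw [e]
    rw [sum_comm, sum_congr rfl (g := fun _ => (Nat.card H : ℝ)), sum_const, nsmul_eq_mul]
    intro v _
    rw [sum_boole, Nat.card_eq_fintype_card, Fintype.card_subtype]
    congr 1
    refine card_nbij' (fun x => v 0 - x) (fun x => v 0 - x) ?_ ?_ ?_ ?_ <;>
      intro x hx <;> simp_all
  have htot := sum_le_sum fun x (_ : x ∈ (univ : Finset V)) => hone x
  rw [hsum, sum_const, nsmul_eq_mul, card_univ, pow_succ] at htot
  refine le_of_mul_le_mul_right ?_ hHpos
  linarith

/-- The Fourier coefficients of rank one of the indicator of the frames of a set that is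
pseudo-random with respect to hyperplanes. -/
lemma norm_hat_frameInd_pull_le {S : Set (AffineSubspace F V)} {ξ : ℝ} (hξ : 0 ≤ ξ)
    (hS : S ⊆ flats F V ℓ) (hμ : measure ℓ S ≤ ξ) (hhyp : PseudoRandomHyperplanes ℓ ξ S)
    (hℓ : ℓ ≠ 0) {c : Fin (ℓ + 1) → F} (hc : c ≠ 0) {ψ : AddChar V ℂ} (hψ : ψ ≠ 0) :
    ‖hat (frameInd ℓ S) (pull c ψ)‖ ≤ 4 * ξ / (Fintype.card F : ℝ) ^ ℓ := by
  classical
  have hV : (0 : ℝ) < Fintype.card V := by exact_mod_cast Fintype.card_pos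
  have hq1 : 1 < Fintype.card F := Fintype.one_lt_card
  have hq2 : 2 ≤ Fintype.card F ^ ℓ := by
    have := Nat.one_lt_pow hℓ hq1
    omega
  have hq : (2 : ℝ) ≤ (Fintype.card F : ℝ) ^ ℓ := by exact_mod_cast hq2
  obtain ⟨H, hH, hk, hHψ⟩ := exists_hyperplane_of_char (F := F) hψ
  set Q : ℝ := (Fintype.card F : ℝ) ^ ℓ
  have hHV : Q * (Nat.card H : ℝ) ^ ℓ = (Fintype.card V : ℝ) ^ ℓ := by
    rw [← mul_pow, natCard_submodule, hH, ← Nat.card_eq_fintype_card (α := V),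
      Module.natCard_eq_pow_finrank (K := F) (V := V), Nat.card_eq_fintype_card]
    push_cast
    rw [← pow_succ']
    congr 2
    omega
  have hG := card_frames_tail_mem_le hξ hS hhyp hH
  have hM := card_frames_le hS hξ hμ
  set G : ℝ := (#{v ∈ frames ℓ S | ∀ i : Fin ℓ, v i.succ ∈ H} : ℝ)
  have hQG : Q * G ≤ ξ * (Fintype.card V : ℝ) ^ (ℓ + 1) := by
    calc Q * G ≤ Q * (ξ * (Fintype.card V * (Nat.card H : ℝ) ^ ℓ)) :=
          mul_le_mul_of_nonneg_left hG (by linarith)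
      _ = ξ * Fintype.card V * (Q * (Nat.card H : ℝ) ^ ℓ) := by ring
      _ = _ := by rw [hHV]; ring
  have hhat : hat (frameInd ℓ S) (pull c ψ) =
      (∑ v ∈ frames ℓ S, ψ (dot c v)) / ((Fintype.card V : ℝ) ^ (ℓ + 1) : ℝ) := by
    have h : ∀ v : Fin (ℓ + 1) → V, (frameInd ℓ S v : ℂ) * pull c ψ v =
        if v ∈ frames ℓ S then ψ (dot c v) else 0 := by
      intro v
      unfold frameInd
      split_ifs <;> simp
    rw [hat, Fintype.expect_eq_sum_div_card]
    simp_rw [h]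
    simp
  -- The summand is a character in `a`. The sum vanishes unless that character is trivial, which
  -- forces every basis vector into `H`.
  have hchar : ∀ v : Fin (ℓ + 1) → V, ‖∑ a : Fin ℓ → F, ψ (dot a (Fin.tail v))‖ ≤
      if ∀ i : Fin ℓ, v i.succ ∈ H then Q else 0 := by
    intro v
    let χ : AddChar (Fin ℓ → F) ℂ :=
      { toFun := fun a => ψ (dot a (Fin.tail v))
        map_zero_eq_one' := by simp [zero_dot]
        map_add_eq_mul' := fun a b => by rw [add_dot, AddChar.map_add_eq_mul] }
    have h := AddChar.sum_eq_ite χ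
    change ∑ a : Fin ℓ → F, ψ (dot a (Fin.tail v)) = _ at h
    rw [h]
    by_cases hχ : χ = 0
    · rw [if_pos hχ, if_pos]
      · simp [Q]
      · intro i
        apply hHψ
        intro t
        have h1 : χ (Pi.single i t) = 1 := by rw [hχ]; rfl
        change ψ (dot (Pi.single i t) (Fin.tail v)) = 1 at h1
        rwa [dot, sum_eq_single i (fun j _ hj => by simp [hj]) (by simp),
          Pi.single_eq_same] at h1
    · rw [if_neg hχ, norm_zero]
      split_ifs
      · linarith
      · exact le_rfl
  have hsumQ : ∑ v ∈ frames ℓ S, (if ∀ i : Fin ℓ, v i.succ ∈ H then Q else 0) = Q * G := by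
    rw [← sum_filter, sum_const, nsmul_eq_mul, mul_comm]
  have hnormψ : ∀ x : V, ‖ψ x‖ = 1 := fun x => ψ.norm_apply x
  have hmain : Q * ‖∑ v ∈ frames ℓ S, ψ (dot c v)‖ ≤
      4 * ξ * (Fintype.card V : ℝ) ^ (ℓ + 1) := by
    by_cases hc0 : c 0 = 0
    · have hdot : ∀ v : Fin (ℓ + 1) → V, dot c v = dot (Fin.tail c) (Fin.tail v) := fun v => by
        rw [dot_eq_tail, hc0, zero_smul, zero_add]
      have htail : Fin.tail c ≠ 0 := by
        intro h
        apply hc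
        funext i
        refine Fin.cases hc0 (fun j => ?_) i
        exact congrFun h j
      simp only [hdot]
      have h := card_smul_sum_frames_dot_of_ne_zero S htail ψ
      set T := ∑ v ∈ frames ℓ S, ψ (dot (Fin.tail c) (Fin.tail v))
      have h1 : (Q - 1) * ‖T‖ ≤ Q * G + #(frames ℓ S) := by
        have e1 : (Q - 1) * ‖T‖ = ‖(Fintype.card F ^ ℓ - 1) • T‖ := by
          rw [nsmul_eq_mul, norm_mul, Complex.norm_natCast, Nat.cast_sub (by omega)]
          simp [Q]
        rw [e1, h]
        calc _ ≤ ∑ v ∈ frames ℓ S,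
              ‖∑ a ∈ univ.erase (0 : Fin ℓ → F), ψ (dot a (Fin.tail v))‖ := norm_sum_le _ _
          _ ≤ ∑ v ∈ frames ℓ S, ((if ∀ i : Fin ℓ, v i.succ ∈ H then Q else 0) + 1) := by
              refine sum_le_sum fun v _ => ?_
              rw [sum_erase_eq_sub (mem_univ _)]
              refine (norm_sub_le _ _).trans ?_
              rw [hnormψ]
              linarith [hchar v]
          _ = Q * G + #(frames ℓ S) := by
              rw [sum_add_distrib, hsumQ, sum_const, nsmul_eq_mul, mul_one]
      -- Only q^ℓ - 1 coefficient vectors are averaged here; q^ℓ ≥ 2 costs a factor 2. The omitted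
      -- term `a = 0` costs another, giving 4 in all.
      have h2 : Q * ‖T‖ ≤ 2 * ((Q - 1) * ‖T‖) := by nlinarith [norm_nonneg T]
      linarith
    · have h := card_smul_sum_frames_dot_of_zero_ne S hc0 ψ
      set T := ∑ v ∈ frames ℓ S, ψ (dot c v)
      have e1 : Q * ‖T‖ = ‖(Fintype.card F ^ ℓ) • T‖ := by
        rw [nsmul_eq_mul, norm_mul, Complex.norm_natCast]
        simp [Q]
      have h1 : Q * ‖T‖ ≤ Q * G := by
        rw [e1, h, ← hsumQ]
        refine (norm_sum_le _ _).trans (sum_le_sum fun v _ => ?_)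
        simp_rw [AddChar.map_add_eq_mul, ← mul_sum]
        rw [norm_mul, hnormψ, one_mul]
        exact hchar v
      have : 0 ≤ ξ * (Fintype.card V : ℝ) ^ (ℓ + 1) := by positivity
      linarith
  rw [hhat, norm_div, Complex.norm_real, Real.norm_of_nonneg (by positivity),
    div_le_div_iff₀ (by positivity) (by linarith)]
  linarith

end FourierBounds

/-! ### Counting steps of the frame walk and flats in flats -/

section Walk

variable {F : Type*} [Field F] [Fintype F] {V : Type*} [AddCommGroup V] [Module F V] [Fintype V]
  {ℓ : ℕ}

lemma frameCount_eq {m ℓ : ℕ} (h : ℓ ≤ m) :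
    (frameCount F m ℓ : ℝ) = (Fintype.card F : ℝ) ^ m *
      ∏ i ∈ range ℓ, ((Fintype.card F : ℝ) ^ m - (Fintype.card F : ℝ) ^ i) := by
  classical
  have h1 := card_linearIndependent (K := F) (V := Fin m → F) (k := ℓ) (by simpa using h)
  have h2 : frameCount F m ℓ = Fintype.card F ^ m *
      Nat.card {s : Fin ℓ → Fin m → F // LinearIndependent F s} := by
    have e : ({x : (Fin m → F) × (Fin ℓ → Fin m → F) | LinearIndependent F x.2} : Finset _) =
        univ ×ˢ ({s : Fin ℓ → Fin m → F | LinearIndependent F s} : Finset _) := by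
      ext x; simp
    rw [frameCount, e, card_product, Nat.card_eq_fintype_card, Fintype.card_subtype]
    simp
  rw [h2, h1, Nat.cast_mul, Nat.cast_pow, Nat.cast_prod,
    prod_range fun i => (Fintype.card F : ℝ) ^ m - (Fintype.card F : ℝ) ^ i]
  congr 1
  refine prod_congr rfl fun i _ => ?_
  rw [Module.finrank_fin_fun, Nat.cast_sub (Nat.pow_le_pow_right Fintype.card_pos (by omega))]
  push_cast
  rfl

lemma frameCount_self_pos : (0 : ℝ) < frameCount F ℓ ℓ := by
  have hq : (1 : ℝ) < Fintype.card F := by exact_mod_cast Fintype.one_lt_card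
  rw [frameCount_eq le_rfl]
  refine mul_pos (by positivity) (prod_pos fun i hi => ?_)
  rw [sub_pos]
  exact pow_lt_pow_right₀ hq (mem_range.1 hi)

lemma frameCount_succ (hℓ : ℓ ≠ 0) :
    (frameCount F (ℓ + 1) ℓ : ℝ) * (Fintype.card F - 1) =
      frameCount F ℓ ℓ * (Fintype.card F * ((Fintype.card F : ℝ) ^ (ℓ + 1) - 1)) := by
  rw [frameCount_eq (Nat.le_add_right ℓ 1), frameCount_eq le_rfl]
  obtain ⟨j, rfl⟩ : ∃ j, ℓ = j + 1 := Nat.exists_eq_succ_of_ne_zero hℓ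
  set q : ℝ := (Fintype.card F : ℝ)
  rw [prod_range_succ', prod_range_succ]
  have h : ∏ i ∈ range j, (q ^ (j + 1 + 1) - q ^ (i + 1)) =
      q ^ j * ∏ i ∈ range j, (q ^ (j + 1) - q ^ i) := by
    have : ∀ i, q ^ (j + 1 + 1) - q ^ (i + 1) = q * (q ^ (j + 1) - q ^ i) := fun i => by ring
    simp_rw [this]
    rw [prod_mul_distrib]
    simp
  rw [h]
  ring

/-- The number of `ℓ`-flats in an `(ℓ+1)`-flat. -/
lemma ncard_flatsIn_succ (hℓ : ℓ ≠ 0) {B : AffineSubspace F V} (hB : B ∈ flats F V (ℓ + 1)) :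
    ((flatsIn ℓ B).ncard : ℝ) * (Fintype.card F - 1) =
      Fintype.card F * ((Fintype.card F : ℝ) ^ (ℓ + 1) - 1) := by
  have h1 := card_frames (ℓ := ℓ) (S := flatsIn ℓ B) (fun A hA => hA.1)
  rw [card_frames_flatsIn hB] at h1
  have h2 := frameCount_succ (F := F) hℓ
  rw [h1, mul_assoc] at h2
  exact mul_left_cancel₀ frameCount_self_pos.ne' h2

lemma tail_add_tens (v : Fin (ℓ + 1) → V) (a : Fin (ℓ + 1) → F) (w : V) :
    Fin.tail (v + tens a w) = Fin.tail v + tens (Fin.tail a) w := rfl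

open Classical in
/-- Moving in a direction of the flat. -/
lemma le_card_step_of_mem {S : Set (AffineSubspace F V)} {v : Fin (ℓ + 1) → V}
    (hv : v ∈ frames ℓ S) {w : V} (hw : w ∈ (flatOf F v).direction) :
    Fintype.card F ^ ℓ ≤ #{a : Fin (ℓ + 1) → F | v + tens a w ∈ frames ℓ S} := by
  obtain ⟨hli, hvS⟩ := mem_frames.1 hv
  have hw' := hw
  rw [direction_flatOf, mem_span_range_iff_dot] at hw
  obtain ⟨b, hb⟩ := hw
  -- If `Fin.tail a` is orthogonal to the coordinates `b` of `w`, the moved directions remain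
  -- independent, hence still span the same direction. The entry `a 0` is unconstrained because the
  -- base point stays in the flat.
  let φ : (Fin (ℓ + 1) → F) →ₗ[F] F := dotProductBilin F F (Fin.cons 0 b : Fin (ℓ + 1) → F)
  have hφ : ∀ a, φ a = b ⬝ᵥ Fin.tail a := by
    intro a
    change (Fin.cons 0 b : Fin (ℓ + 1) → F) ⬝ᵥ a = _
    simp [dotProduct, Fin.sum_univ_succ, Fin.tail]
  have hcard : Fintype.card F ^ ℓ ≤ #{a : Fin (ℓ + 1) → F | a ∈ LinearMap.ker φ} := by
    have h1 := LinearMap.finrank_range_add_finrank_ker φ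
    have h2 : Module.finrank F (LinearMap.range φ) ≤ 1 := by
      have := Submodule.finrank_le (LinearMap.range φ)
      simpa using this
    rw [Module.finrank_fin_fun] at h1
    have h3 := natCard_submodule (LinearMap.ker φ)
    rw [Nat.card_eq_fintype_card, Fintype.card_subtype] at h3
    refine le_trans (Nat.pow_le_pow_right Fintype.card_pos ?_) h3.ge
    omega
  refine hcard.trans (card_le_card fun a ha => ?_)
  simp only [mem_filter, mem_univ, true_and, LinearMap.mem_ker, hφ] at ha ⊢
  have hli' : LinearIndependent F (Fin.tail (v + tens a w)) := by
    rw [linearIndependent_iff_dot]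
    intro x hx
    rw [tail_add_tens, dot_add, dot_tens, ← hb, ← smul_dot, ← add_dot] at hx
    have h1 := linearIndependent_iff_dot.1 hli _ hx
    have h2 : x ⬝ᵥ Fin.tail a = 0 := by
      have := congrArg (fun y => y ⬝ᵥ Fin.tail a) h1
      simpa [add_dotProduct, smul_dotProduct, ha] using this
    simpa [h2] using h1
  have he : flatOf F (v + tens a w) = flatOf F v := by
    refine flatOf_eq hli' (flatOf_mem_flats hli) ?_ ?_
    · have := AffineSubspace.vadd_mem_of_mem_direction
        ((flatOf F v).direction.smul_mem (a 0) hw') (zero_mem_flatOf (F := F) v)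
      rw [vadd_eq_add, add_comm] at this
      exact this
    · intro i
      exact Submodule.add_mem _ (tail_mem_direction v i)
        ((flatOf F v).direction.smul_mem (a i.succ) hw')
  exact mem_frames.2 ⟨hli', he ▸ hvS⟩

lemma sup_span_eq_of_finrank {P Q : Submodule F V} (hPQ : P ≤ Q)
    (hP : Module.finrank F Q = Module.finrank F P + 1) {w : V} (hw : w ∈ Q) (hwP : w ∉ P) :
    P ⊔ Submodule.span F {w} = Q := by
  have hle : P ⊔ Submodule.span F {w} ≤ Q :=
    sup_le hPQ (by rw [Submodule.span_le]; simpa using hw)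
  have hlt : P < P ⊔ Submodule.span F {w} := by
    refine lt_of_le_of_ne le_sup_left fun h => hwP ?_
    rw [h]
    exact Submodule.mem_sup_right (Submodule.mem_span_singleton_self w)
  have := Submodule.finrank_lt_finrank_of_lt hlt
  exact Submodule.eq_of_le_of_finrank_le hle (by omega)

open Classical in
/-- Moving in a direction outside the flat reaches all the complementary flats. -/
lemma card_flats_le_card_step {S : Set (AffineSubspace F V)} {v : Fin (ℓ + 1) → V} (hv : v ∈ frames ℓ S)
    {w : V} (hw : w ∉ (flatOf F v).direction) {B : AffineSubspace F V}
    (hB : B ∈ flatsAbove (ℓ + 1) (flatOf F v)) (hwB : w ∈ B.direction) :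
    #{A ∈ (flatsIn ℓ B ∩ S).toFinset | w ∉ A.direction} ≤
      #{a : Fin (ℓ + 1) → F | v + tens a w ∈ frames ℓ S} := by
  obtain ⟨hli, hvS⟩ := mem_frames.1 hv
  obtain ⟨hBf, hle⟩ := hB
  refine card_le_card_of_surjOn (fun a => flatOf F (v + tens a w)) ?_
  intro A hA
  simp only [coe_filter, Set.mem_toFinset] at hA
  obtain ⟨⟨⟨hAf, hAB⟩, hAS⟩, hwA⟩ := hA
  obtain ⟨p, hp⟩ := hAf.1
  have hsup := sup_span_eq_of_finrank (AffineSubspace.direction_le hAB)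
    (by rw [hBf.2, hAf.2]) hwB hwA
  -- As `w` complements the direction of the target flat in that of `B`, each vector of the frame
  -- can be slid along `w` into the target; the amounts form the coefficient vector `a`.
  have hex : ∀ y ∈ B.direction, ∃ t : F, y + t • w ∈ A.direction := by
    intro y hy
    rw [← hsup, Submodule.mem_sup] at hy
    obtain ⟨y₁, h₁, y₂, h₂, rfl⟩ := hy
    obtain ⟨t, rfl⟩ := Submodule.mem_span_singleton.1 h₂
    exact ⟨-t, by simpa using h₁⟩
  obtain ⟨t₀, ht₀⟩ := hex (v 0 - p) (by
    simpa using AffineSubspace.vsub_mem_direction (hle (zero_mem_flatOf v)) (hAB hp))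
  choose t ht using fun i : Fin ℓ => hex (v i.succ)
    (AffineSubspace.direction_le hle (tail_mem_direction v i))
  let a : Fin (ℓ + 1) → F := Fin.cons t₀ t
  have hli' : LinearIndependent F (Fin.tail (v + tens a w)) := by
    rw [linearIndependent_iff_dot]
    intro x hx
    rw [tail_add_tens, dot_add, dot_tens] at hx
    have h1 : x ⬝ᵥ Fin.tail a = 0 := by
      by_contra hne
      apply hw
      rw [direction_flatOf]
      have h2 : (x ⬝ᵥ Fin.tail a) • w ∈ Submodule.span F (Set.range (Fin.tail v)) := by
        rw [eq_neg_of_add_eq_zero_right hx]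
        exact Submodule.neg_mem _ (mem_span_range_iff_dot.2 ⟨x, rfl⟩)
      exact (Submodule.smul_mem_iff _ hne).1 h2
    rw [h1, zero_smul, add_zero] at hx
    exact linearIndependent_iff_dot.1 hli _ hx
  have he : flatOf F (v + tens a w) = A := by
    refine flatOf_eq hli' hAf ?_ ?_
    · have h1 := AffineSubspace.vadd_mem_of_mem_direction ht₀ hp
      have h2 : (v 0 - p + t₀ • w) +ᵥ p = (v + tens a w) 0 := by
        simp only [vadd_eq_add, Pi.add_apply, tens, a, Fin.cons_zero]
        abel
      rwa [h2] at h1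
    · intro i
      have h1 := ht i
      simpa [Fin.tail, tens, a] using h1
  refine ⟨a, ?_, he⟩
  simp only [coe_filter, mem_univ, true_and]
  exact mem_frames.2 ⟨hli', he.symm ▸ hAS⟩

open Classical in
lemma card_mem_submodule (P : Submodule F V) :
    (#{w : V | w ∈ P} : ℝ) = (Fintype.card F : ℝ) ^ Module.finrank F P := by
  have := natCard_submodule P
  rw [Nat.card_eq_fintype_card, Fintype.card_subtype] at this
  rw [this]
  push_cast
  rfl

open Classical in
/-- The number of vectors outside two hyperplanes. -/
lemma le_card_notMem_notMem {P Q R : Submodule F V} (hP : Module.finrank F P = ℓ)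
    (hQ : Module.finrank F Q = ℓ) (hR : Module.finrank F R = ℓ + 1) (hPR : P ≤ R) (hQR : Q ≤ R)
    (hℓ : ℓ ≠ 0) :
    ((Fintype.card F : ℝ) - 1) ^ 2 * (Fintype.card F : ℝ) ^ (ℓ - 1) ≤
      #{w : V | w ∈ R ∧ w ∉ P ∧ w ∉ Q} := by
  have hq : (1 : ℝ) < Fintype.card F := by exact_mod_cast Fintype.one_lt_card
  have hR' := card_mem_submodule R
  have hP' := card_mem_submodule P
  have hQ' := card_mem_submodule Q
  have hI' := card_mem_submodule (P ⊓ Q)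
  -- Two hyperplanes of `R` meet in codimension at most 2; inclusion-exclusion then gives the count,
  -- attained when they differ.
  have hfr : ℓ - 1 ≤ Module.finrank F (P ⊓ Q : Submodule F V) := by
    have h1 := Submodule.finrank_sup_add_finrank_inf_eq P Q
    have h2 := Submodule.finrank_mono (sup_le hPR hQR)
    omega
  have hI : (Fintype.card F : ℝ) ^ (ℓ - 1) ≤ #{w : V | w ∈ P ⊓ Q} := by
    rw [hI']
    exact pow_le_pow_right₀ hq.le hfr
  have hunion := card_union_add_card_inter ({w : V | w ∈ P} : Finset V) ({w : V | w ∈ Q} : Finset V)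
  have hinter : ({w : V | w ∈ P} : Finset V) ∩ ({w : V | w ∈ Q} : Finset V) =
      ({w : V | w ∈ P ⊓ Q} : Finset V) := by
    ext w; simp
  have hsplit : #{w : V | w ∈ R ∧ w ∉ P ∧ w ∉ Q} +
      #(({w : V | w ∈ P} : Finset V) ∪ ({w : V | w ∈ Q} : Finset V)) = #{w : V | w ∈ R} := by
    rw [← card_union_of_disjoint]
    · congr 1
      ext w
      simp only [mem_union, mem_filter, mem_univ, true_and]
      constructor
      · rintro (h | h | h)
        · exact h.1
        · exact hPR h
        · exact hQR h
      · intro h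
        by_cases h1 : w ∈ P <;> by_cases h2 : w ∈ Q <;> simp [h, h1, h2]
    · rw [disjoint_left]
      intro w h1 h2
      simp only [mem_union, mem_filter, mem_univ, true_and] at h1 h2
      rcases h2 with h2 | h2
      · exact h1.2.1 h2
      · exact h1.2.2 h2
  rw [hinter] at hunion
  have hunion' : (#(({w : V | w ∈ P} : Finset V) ∪ ({w : V | w ∈ Q} : Finset V)) : ℝ) +
      #{w : V | w ∈ P ⊓ Q} = #{w : V | w ∈ P} + #{w : V | w ∈ Q} := by exact_mod_cast hunion
  have hsplit' : (#{w : V | w ∈ R ∧ w ∉ P ∧ w ∉ Q} : ℝ) +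
      #(({w : V | w ∈ P} : Finset V) ∪ ({w : V | w ∈ Q} : Finset V)) = #{w : V | w ∈ R} := by
    exact_mod_cast hsplit
  rw [hP'.trans (by rw [hP]), hQ'.trans (by rw [hQ])] at hunion'
  rw [hR'.trans (by rw [hR])] at hsplit'
  obtain ⟨j, rfl⟩ : ∃ j, ℓ = j + 1 := Nat.exists_eq_succ_of_ne_zero hℓ
  simp only [Nat.add_sub_cancel] at *
  set q : ℝ := (Fintype.card F : ℝ)
  have e : (q - 1) ^ 2 * q ^ j = q ^ (j + 1 + 1) - (q ^ (j + 1) + q ^ (j + 1)) + q ^ j := by ring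
  linarith

lemma mk'_mem_flatsAbove {A : AffineSubspace F V} (hA : A ∈ flats F V ℓ) {p : V} (hp : p ∈ A)
    {w : V} (hw : w ∉ A.direction) :
    AffineSubspace.mk' p (A.direction ⊔ Submodule.span F {w}) ∈ flatsAbove (ℓ + 1) A := by
  refine ⟨⟨AffineSubspace.mk'_nonempty _ _, ?_⟩, ?_⟩
  · rw [AffineSubspace.direction_mk']
    have h1 := Submodule.finrank_add_le_finrank_add_finrank A.direction (Submodule.span F {w})
    have h2 : Module.finrank F (Submodule.span F {w}) ≤ 1 :=
      (finrank_span_singleton fun h => hw (by rw [h]; exact Submodule.zero_mem _)).le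
    have hlt : A.direction < A.direction ⊔ Submodule.span F {w} := by
      refine lt_of_le_of_ne le_sup_left fun h => hw ?_
      rw [h]
      exact Submodule.mem_sup_right (Submodule.mem_span_singleton_self w)
    have h3 := Submodule.finrank_lt_finrank_of_lt hlt
    have h4 := hA.2
    omega
  · intro y hy
    rw [AffineSubspace.mem_mk']
    exact Submodule.mem_sup_left (AffineSubspace.vsub_mem_direction hy hp)

-- Each vector outside the direction of `A` lies in the direction of some (ℓ+1)-flat above `A`, and
-- each such flat accounts for q^(ℓ+1) - q^ℓ of them.
open Classical in
lemma card_notMem_direction_le {A : AffineSubspace F V} (hA : A ∈ flats F V ℓ) :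
    (Fintype.card V : ℝ) - (Fintype.card F : ℝ) ^ ℓ ≤
      (flatsAbove (ℓ + 1) A).ncard *
        ((Fintype.card F : ℝ) ^ (ℓ + 1) - (Fintype.card F : ℝ) ^ ℓ) := by
  obtain ⟨p, hp⟩ := hA.1
  have hcov : ({w : V | w ∉ A.direction} : Finset V) ⊆ (flatsAbove (ℓ + 1) A).toFinset.biUnion
      fun B => {w : V | w ∈ B.direction ∧ w ∉ A.direction} := by
    intro w hw
    rw [mem_filter] at hw
    rw [mem_biUnion]
    refine ⟨_, Set.mem_toFinset.2 (mk'_mem_flatsAbove hA hp hw.2), ?_⟩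
    simp only [mem_filter, mem_univ, true_and, AffineSubspace.direction_mk']
    exact ⟨Submodule.mem_sup_right (Submodule.mem_span_singleton_self w), hw.2⟩
  have hdiff : ∀ P : Submodule F V, A.direction ≤ P →
      (#{w : V | w ∈ P ∧ w ∉ A.direction} : ℝ) =
        (Fintype.card F : ℝ) ^ Module.finrank F P - (Fintype.card F : ℝ) ^ ℓ := by
    intro P hP
    have h1 : #{w : V | w ∈ P ∧ w ∉ A.direction} + #{w : V | w ∈ A.direction} =
        #{w : V | w ∈ P} := by
      rw [← card_union_of_disjoint]
      · congr 1
        ext w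
        simp only [mem_union, mem_filter, mem_univ, true_and]
        constructor
        · rintro (h | h)
          · exact h.1
          · exact hP h
        · intro h
          by_cases h1 : w ∈ A.direction <;> simp [h, h1]
      · rw [disjoint_left]
        intro w h1 h2
        simp only [mem_filter, mem_univ, true_and] at h1 h2
        exact h1.2 h2
    have h2 : (#{w : V | w ∈ P ∧ w ∉ A.direction} : ℝ) + #{w : V | w ∈ A.direction} =
        #{w : V | w ∈ P} := by exact_mod_cast h1
    rw [card_mem_submodule P, card_mem_submodule A.direction, hA.2] at h2
    linarith
  have hV : (#{w : V | w ∉ A.direction} : ℝ) =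
      (Fintype.card V : ℝ) - (Fintype.card F : ℝ) ^ ℓ := by
    have h := hdiff ⊤ le_top
    have e : (Fintype.card V : ℝ) = (Fintype.card F : ℝ) ^ Module.finrank F V := by
      exact_mod_cast Module.card_eq_pow_finrank (K := F) (V := V)
    rw [finrank_top, ← e] at h
    rw [← h]
    congr 2
    ext w
    simp
  have hle : (#{w : V | w ∉ A.direction} : ℝ) ≤ ∑ B ∈ (flatsAbove (ℓ + 1) A).toFinset,
      (#{w : V | w ∈ B.direction ∧ w ∉ A.direction} : ℝ) := by
    exact_mod_cast (card_le_card hcov).trans card_biUnion_le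
  rw [← hV]
  refine hle.trans (le_of_eq ?_)
  rw [sum_congr rfl (g := fun _ => (Fintype.card F : ℝ) ^ (ℓ + 1) - (Fintype.card F : ℝ) ^ ℓ),
    sum_const, nsmul_eq_mul, Set.ncard_eq_toFinset_card']
  intro B hB
  rw [Set.mem_toFinset] at hB
  rw [hdiff _ (AffineSubspace.direction_le hB.2), hB.1.2]

lemma flatsAbove_eq_of_mem {A B B' : AffineSubspace F V} (hA : A ∈ flats F V ℓ)
    (hB : B ∈ flatsAbove (ℓ + 1) A) (hB' : B' ∈ flatsAbove (ℓ + 1) A) {w : V}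
    (hw : w ∉ A.direction) (hwB : w ∈ B.direction) (hwB' : w ∈ B'.direction) : B = B' := by
  obtain ⟨p, hp⟩ := hA.1
  have h1 := sup_span_eq_of_finrank (AffineSubspace.direction_le hB.2)
    (by rw [hB.1.2, hA.2]) hwB hw
  have h2 := sup_span_eq_of_finrank (AffineSubspace.direction_le hB'.2)
    (by rw [hB'.1.2, hA.2]) hwB' hw
  rw [← AffineSubspace.mk'_eq (hB.2 hp), ← AffineSubspace.mk'_eq (hB'.2 hp), ← h1, ← h2]

end Walk

/-! ### Elementary properties of `prob` and `avg` -/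

section Averages

variable {α : Type*} [Finite α]

lemma prob_nonneg (E T : Set α) : 0 ≤ prob E T := div_nonneg (Nat.cast_nonneg _) (Nat.cast_nonneg _)

lemma prob_compl {E : Set α} (hE : E.Nonempty) (T : Set α) : prob E Tᶜ = 1 - prob E T := by
  have hpos : (0 : ℝ) < E.ncard := by exact_mod_cast (Set.ncard_pos (Set.toFinite E)).2 hE
  have h := Set.ncard_inter_add_ncard_sdiff_eq_ncard E T (Set.toFinite E)
  have h' : ((E ∩ T).ncard : ℝ) + ((E ∩ Tᶜ).ncard : ℝ) = E.ncard := by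
    rw [← Set.sdiff_eq]
    exact_mod_cast h
  rw [prob, prob, eq_sub_iff_add_eq, ← add_div, add_comm, h', div_self hpos.ne']

lemma avg_mul_ncard {E : Set α} (hE : E.Nonempty) (f : α → ℝ) :
    avg E f * E.ncard = ∑ᶠ a ∈ E, f a := by
  have hpos : (0 : ℝ) < E.ncard := by exact_mod_cast (Set.ncard_pos (Set.toFinite E)).2 hE
  rw [avg, div_mul_cancel₀ _ hpos.ne']

lemma avg_one_sub {E : Set α} (hE : E.Nonempty) {f g : α → ℝ} (h : ∀ a ∈ E, f a = 1 - g a) :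
    avg E f = 1 - avg E g := by
  classical
  have hpos : (0 : ℝ) < E.ncard := by exact_mod_cast (Set.ncard_pos (Set.toFinite E)).2 hE
  have : Fintype E := Fintype.ofFinite _
  rw [avg, avg, eq_sub_iff_add_eq, ← add_div, div_eq_one_iff_eq hpos.ne',
    finsum_mem_eq_toFinset_sum, finsum_mem_eq_toFinset_sum, ← sum_add_distrib,
    sum_congr rfl (g := fun _ => (1 : ℝ)), Set.ncard_eq_toFinset_card']
  · simp
  · intro a ha
    rw [h a (by simpa using ha)]
    ring

lemma avg_nonneg {E : Set α} {f : α → ℝ} (h : ∀ a, 0 ≤ f a) : 0 ≤ avg E f :=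
  div_nonneg (finsum_nonneg fun _ => finsum_nonneg fun _ => h _) (Nat.cast_nonneg _)

end Averages

/-! ### Comparison of the frame walk with the affine Grassmann walk -/

section WalkBound

variable {F : Type*} [Field F] [Fintype F] {V : Type*} [AddCommGroup V] [Module F V] [Fintype V]
  {ℓ : ℕ}

lemma flatsAbove_nonempty (hk : ℓ < Module.finrank F V) {A : AffineSubspace F V}
    (hA : A ∈ flats F V ℓ) : (flatsAbove (ℓ + 1) A).Nonempty := by
  obtain ⟨p, hp⟩ := hA.1
  obtain ⟨w, hw⟩ : ∃ w, w ∉ A.direction := by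
    by_contra! h
    have : A.direction = ⊤ := eq_top_iff.2 fun x _ => h x
    have h2 := hA.2
    rw [this, finrank_top] at h2
    omega
  exact ⟨_, mk'_mem_flatsAbove hA hp hw⟩

lemma stepProb_compl (hk : ℓ < Module.finrank F V) {A : AffineSubspace F V}
    (hA : A ∈ flats F V ℓ) (S : Set (AffineSubspace F V)) :
    stepProb ℓ A Sᶜ = 1 - stepProb ℓ A S :=
  avg_one_sub (flatsAbove_nonempty hk hA) fun B hB =>
    prob_compl (show (flatsIn ℓ B).Nonempty from ⟨A, hA, hB.2⟩) S

lemma stepProb_nonneg (A : AffineSubspace F V) (S : Set (AffineSubspace F V)) :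
    0 ≤ stepProb ℓ A S :=
  avg_nonneg fun _ => prob_nonneg _ _

open Classical in
/-- A lower bound for the number of steps `v ↦ v + tens a w` that stay inside the frames of `S`. -/
lemma le_sum_card_step {S : Set (AffineSubspace F V)} (hℓ : ℓ ≠ 0) (hk : ℓ < Module.finrank F V)
    {v : Fin (ℓ + 1) → V} (hv : v ∈ frames ℓ S) :
    (Fintype.card F : ℝ) ^ ℓ * (Fintype.card F : ℝ) ^ ℓ +
      ((Fintype.card F : ℝ) ^ (ℓ + 1) - 1) * (Fintype.card V - (Fintype.card F : ℝ) ^ ℓ) *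
        stepProb ℓ (flatOf F v) S ≤
      ∑ w : V, (#{a : Fin (ℓ + 1) → F | v + tens a w ∈ frames ℓ S} : ℝ) := by
  obtain ⟨hli, hvS⟩ := mem_frames.1 hv
  have hA := flatOf_mem_flats hli
  set A := flatOf F v
  have hq : (1 : ℝ) < Fintype.card F := by exact_mod_cast Fintype.one_lt_card
  let c : V → ℝ := fun w => #{a : Fin (ℓ + 1) → F | v + tens a w ∈ frames ℓ S}
  have hc0 : ∀ w, 0 ≤ c w := fun w => Nat.cast_nonneg _
  rw [← sum_filter_add_sum_filter_not univ (fun w => w ∈ A.direction)]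
  refine add_le_add ?_ ?_
  · have h1 : ∀ w ∈ ({w : V | w ∈ A.direction} : Finset V), (Fintype.card F : ℝ) ^ ℓ ≤ c w := by
      intro w hw
      have := le_card_step_of_mem hv (mem_filter.1 hw).2
      simp only [c]
      exact_mod_cast this
    have h2 := card_nsmul_le_sum _ _ _ h1
    rw [nsmul_eq_mul, card_mem_submodule, hA.2] at h2
    exact h2
  · set U := (flatsAbove (ℓ + 1) A).toFinset
    have hU : ∀ B, B ∈ U ↔ B ∈ flatsAbove (ℓ + 1) A := fun B => Set.mem_toFinset
    let T : AffineSubspace F V → Finset (AffineSubspace F V) := fun B => (flatsIn ℓ B ∩ S).toFinset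
    let D : ℝ := ((Fintype.card F : ℝ) - 1) ^ 2 * (Fintype.card F : ℝ) ^ (ℓ - 1)
    have hD : 0 ≤ D := by positivity
    -- Double counting of triples (B, C, w) with C in `T B` and w in the direction of B but of
    -- neither A nor C. Each pair (B, C) has at least D choices of w; each w determines B and
    -- reaches all the corresponding C.
    have h1 : ∑ B ∈ U, (#(T B) : ℝ) * D ≤ ∑ w ∈ ({w : V | w ∉ A.direction} : Finset V), c w := by
      have hB : ∀ B ∈ U, (#(T B) : ℝ) * D ≤
          ∑ w ∈ ({w : V | w ∉ A.direction} : Finset V), if w ∈ B.direction then c w else 0 := by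
        intro B hBU
        rw [hU] at hBU
        have h2 : ∀ C ∈ T B, D ≤ ∑ w ∈ ({w : V | w ∉ A.direction} : Finset V),
            if w ∈ B.direction ∧ w ∉ C.direction then (1 : ℝ) else 0 := by
          intro C hC
          have hC' : C ∈ flatsIn ℓ B ∩ S := Set.mem_toFinset.1 hC
          have := le_card_notMem_notMem hA.2 hC'.1.1.2 hBU.1.2 (AffineSubspace.direction_le hBU.2)
            (AffineSubspace.direction_le hC'.1.2) hℓ
          rw [sum_boole, filter_filter]
          refine this.trans (le_of_eq ?_)
          congr 2
          ext w
          simp only [mem_filter, mem_univ, true_and]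
          tauto
        have h3 := card_nsmul_le_sum _ _ _ h2
        rw [nsmul_eq_mul] at h3
        refine h3.trans ?_
        rw [sum_comm]
        refine sum_le_sum fun w hw => ?_
        have hwA : w ∉ A.direction := (mem_filter.1 hw).2
        split_ifs with hwB
        · simp only [hwB, true_and]
          rw [sum_boole]
          have := card_flats_le_card_step hv hwA hBU hwB
          simp only [c]
          exact_mod_cast this
        · simp [hwB]
      refine (sum_le_sum hB).trans ?_
      rw [sum_comm]
      refine sum_le_sum fun w hw => ?_
      have hwA : w ∉ A.direction := (mem_filter.1 hw).2
      rw [← sum_filter, sum_const, nsmul_eq_mul]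
      have h4 : #{B ∈ U | w ∈ B.direction} ≤ 1 := by
        rw [card_le_one]
        intro B hB B' hB'
        rw [mem_filter, hU] at hB hB'
        exact flatsAbove_eq_of_mem hA hB.1 hB'.1 hwA hB.2 hB'.2
      have h5 : (#{B ∈ U | w ∈ B.direction} : ℝ) ≤ 1 := by exact_mod_cast h4
      exact mul_le_of_le_one_left (hc0 w) h5
    refine le_trans ?_ h1
    -- The number of `ℓ`-flats in B is q(q^(ℓ+1) - 1)/(q - 1), which cancels one factor q - 1 of D.
    have h6 : ∀ B ∈ U, (#(T B) : ℝ) * D = prob (flatsIn ℓ B) S *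
        (((Fintype.card F : ℝ) ^ (ℓ + 1) - 1) *
          ((Fintype.card F : ℝ) ^ (ℓ + 1) - (Fintype.card F : ℝ) ^ ℓ)) := by
      intro B hBU
      rw [hU] at hBU
      have hN := ncard_flatsIn_succ hℓ hBU.1
      have hpos : (0 : ℝ) < (flatsIn ℓ B).ncard := by
        exact_mod_cast (Set.ncard_pos (Set.toFinite _)).2
          (show (flatsIn ℓ B).Nonempty from ⟨A, hA, hBU.2⟩)
      have hT : (#(T B) : ℝ) = prob (flatsIn ℓ B) S * (flatsIn ℓ B).ncard := by
        rw [prob, div_mul_cancel₀ _ hpos.ne', Set.ncard_eq_toFinset_card']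
      have hpow : (Fintype.card F : ℝ) ^ (ℓ - 1) * Fintype.card F = (Fintype.card F : ℝ) ^ ℓ := by
        rw [← pow_succ]; congr 1; omega
      calc (#(T B) : ℝ) * D = prob (flatsIn ℓ B) S *
            (((flatsIn ℓ B).ncard : ℝ) * (Fintype.card F - 1)) *
              ((Fintype.card F - 1) * (Fintype.card F : ℝ) ^ (ℓ - 1)) := by
            rw [hT]; simp only [D]; ring
        _ = prob (flatsIn ℓ B) S * (((Fintype.card F : ℝ) ^ (ℓ + 1) - 1) *
              ((Fintype.card F - 1) *
                ((Fintype.card F : ℝ) ^ (ℓ - 1) * Fintype.card F))) := by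
            rw [hN]; ring
        _ = _ := by rw [hpow, pow_succ]; ring
    rw [sum_congr rfl h6, ← sum_mul]
    have h7 : ∑ B ∈ U, prob (flatsIn ℓ B) S =
        stepProb ℓ A S * (flatsAbove (ℓ + 1) A).ncard := by
      rw [stepProb, avg_mul_ncard (flatsAbove_nonempty hk hA), finsum_mem_eq_toFinset_sum]
    rw [h7]
    have h8 := card_notMem_direction_le hA
    have h9 : 0 ≤ ((Fintype.card F : ℝ) ^ (ℓ + 1) - 1) * stepProb ℓ A S :=
      mul_nonneg (sub_nonneg.2 (one_le_pow₀ hq.le)) (stepProb_nonneg _ _)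
    have h10 := mul_le_mul_of_nonneg_left h8 h9
    linarith

/-- The frame walk stays inside `S` almost as often as the walk on the affine Grassmann graph. -/
lemma le_expect_walk {S : Set (AffineSubspace F V)} (hS : S ⊆ flats F V ℓ) (hne : S.Nonempty)
    (hℓ : ℓ ≠ 0) (hk : ℓ < Module.finrank F V)
    (hexp : 1 - expansion ℓ S ≥ 1 / (Fintype.card F : ℝ)) :
    (1 - 1 / (Fintype.card F : ℝ) ^ (ℓ + 1)) / Fintype.card F * 𝔼 v, frameInd ℓ S v ≤
      𝔼 a : Fin (ℓ + 1) → F, 𝔼 w : V, 𝔼 v, frameInd ℓ S v * frameInd ℓ S (v + tens a w) := by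
  classical
  have hq : (1 : ℝ) < Fintype.card F := by exact_mod_cast Fintype.one_lt_card
  have hV : (0 : ℝ) < Fintype.card V := by exact_mod_cast Fintype.card_pos
  have hVq : (Fintype.card F : ℝ) ^ ℓ ≤ Fintype.card V := by
    have e : (Fintype.card V : ℝ) = (Fintype.card F : ℝ) ^ Module.finrank F V := by
      exact_mod_cast Module.card_eq_pow_finrank (K := F) (V := V)
    rw [e]
    exact pow_le_pow_right₀ hq.le hk.le
  have hstep : (#(frames ℓ S) : ℝ) / Fintype.card F ≤
      ∑ v ∈ frames ℓ S, stepProb ℓ (flatOf F v) S := by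
    have h1 : 1 - expansion ℓ S = avg S fun A => stepProb ℓ A S := by
      rw [expansion, avg_one_sub hne (g := fun A => stepProb ℓ A S)
        fun A hA => stepProb_compl hk (hS hA) S]
      ring
    rw [h1] at hexp
    have h2 := avg_mul_ncard hne fun A => stepProb ℓ A S
    rw [finsum_mem_eq_toFinset_sum] at h2
    rw [sum_frames hS fun A => stepProb ℓ A S, ← h2, card_frames hS]
    have h3 : (0 : ℝ) ≤ frameCount F ℓ ℓ * S.ncard := by positivity
    have h4 := mul_le_mul_of_nonneg_left hexp.le h3
    calc _ = (frameCount F ℓ ℓ * S.ncard : ℝ) * (1 / Fintype.card F) := by ring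
      _ ≤ _ := h4
      _ = _ := by ring
  have hsum : 𝔼 a : Fin (ℓ + 1) → F, 𝔼 w : V, 𝔼 v,
      frameInd ℓ S v * frameInd ℓ S (v + tens a w) =
      (∑ v ∈ frames ℓ S, ∑ w : V, (#{a : Fin (ℓ + 1) → F | v + tens a w ∈ frames ℓ S} : ℝ)) /
        ((Fintype.card F : ℝ) ^ (ℓ + 1) * Fintype.card V * (Fintype.card V : ℝ) ^ (ℓ + 1)) := by
    simp_rw [Fintype.expect_eq_sum_div_card, ← sum_div, div_div]
    rw [Fintype.card_fun, Fintype.card_fun, Fintype.card_fin]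
    push_cast
    congr 1
    · rw [sum_comm]
      rw [sum_congr rfl fun w _ => sum_comm]
      rw [sum_comm]
      rw [← sum_subset (subset_univ (frames ℓ S))]
      · refine sum_congr rfl fun v hv => sum_congr rfl fun w _ => ?_
        simp [frameInd, hv]
      · intro v _ hv
        simp [frameInd, hv]
    · ring
  rw [hsum, expect_frameInd]
  have hmain := sum_le_sum fun v hv => le_sum_card_step (S := S) hℓ hk hv
  rw [sum_add_distrib, sum_const, nsmul_eq_mul, ← mul_sum] at hmain
  set q : ℝ := (Fintype.card F : ℝ)
  set N : ℝ := (#(frames ℓ S) : ℝ)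
  set X : ℝ := (Fintype.card V : ℝ)
  have hN : 0 ≤ N := Nat.cast_nonneg _
  have hq1 : 1 ≤ q ^ (ℓ + 1) := one_le_pow₀ hq.le
  have hcoef : 0 ≤ (q ^ (ℓ + 1) - 1) * (X - q ^ ℓ) :=
    mul_nonneg (by linarith) (by linarith)
  have h1 := mul_le_mul_of_nonneg_left hstep hcoef
  have hq0 : 0 < q := by linarith
  have hlow : N * ((q ^ (ℓ + 1) - 1) * X / q) ≤
      N * (q ^ ℓ * q ^ ℓ) + (q ^ (ℓ + 1) - 1) * (X - q ^ ℓ) * (N / q) := by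
    -- The moves along the flat itself more than make up for the q^ℓ vectors `w` missing from the
    -- second term.
    have e : N * (q ^ ℓ * q ^ ℓ) + (q ^ (ℓ + 1) - 1) * (X - q ^ ℓ) * (N / q) -
        N * ((q ^ (ℓ + 1) - 1) * X / q) = N * q ^ ℓ / q := by
      field_simp
      ring
    have : 0 ≤ N * q ^ ℓ / q := by positivity
    linarith
  have hfin := hlow.trans ((add_le_add_right h1 _).trans hmain)
  rw [le_div_iff₀ (by positivity)]
  refine le_trans (le_of_eq ?_) hfin
  field_simp

end WalkBound

/-! ### Numerical combination of the bounds -/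

section Conclusion

/-- A near-optimal return probability forces almost all the weight to rank one. -/
lemma le_levelWeight_of_walk {q ε M W : ℝ} (hq : 2 ≤ q) (hε : 0 ≤ ε) (hM : 0 ≤ M)
    (h : (1 - ε) / q * M ≤ M ^ 2 + (1 / q - 1 / q ^ 2) * W + 1 / q ^ 2 * M) :
    M * (1 - 2 * ε - 2 * q * M) ≤ W := by
  have hq0 : 0 < q := by linarith
  have h1 := mul_le_mul_of_nonneg_left h (sq_nonneg q)
  have e1 : q ^ 2 * ((1 - ε) / q * M) = q * (1 - ε) * M := by field_simp
  have e2 : q ^ 2 * (M ^ 2 + (1 / q - 1 / q ^ 2) * W + 1 / q ^ 2 * M) =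
      q ^ 2 * M ^ 2 + (q - 1) * W + M := by field_simp
  rw [e1, e2] at h1
  have hq1 : 0 < q - 1 := by linarith
  refine le_of_mul_le_mul_left ?_ hq1
  -- Dividing by q - 1 would produce the factor q/(q - 1), which is at most 2 because q ≥ 2.
  have h2 : 0 ≤ (q - 2) * (M * (ε + q * M)) := by
    refine mul_nonneg (by linarith) (mul_nonneg hM (by positivity))
  nlinarith

/-- Combination of the lower bound for the rank one weight with the fourth moment bound. -/
lemma one_sub_le_of_levelWeight {q δ ξ s M W η Nm : ℝ} (hq : 2 ≤ q) (hs : 0 ≤ s)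
    (hs1 : s ≤ 1) (hξ : ξ = s ^ 2) (hM : 0 < M) (hMξ : M ≤ ξ) (hW0 : 0 ≤ W) (hWM : W ≤ M)
    (hη : 0 ≤ η) (hNm0 : 0 ≤ Nm) (hNm : Nm ≤ 8 * ξ) (hlow : M * (1 - δ - 2 * q * M) ≤ W)
    (h4 : W ^ 2 ≤ M * (√(M * (η ^ 2 * W + W ^ 2)) +
      √(M * (q ^ 4 * W ^ 2 + q ^ 3 * Nm ^ 2 * W)))) :
    1 - 2 * δ ≤ η + 14 * q ^ 2 * s := by
  have hq0 : 0 < q := by linarith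
  have hMs : M ≤ s ^ 2 := hξ ▸ hMξ
  have hsq : s ^ 2 ≤ s := by nlinarith
  -- Diagonal part: W ≤ M ≤ s², and √(η² + s²) ≤ η + s.
  have hA : √(M * (η ^ 2 * W + W ^ 2)) ≤ M * (η + s) := by
    apply Real.sqrt_le_iff.2
    refine ⟨by positivity, ?_⟩
    have h1 : η ^ 2 * W + W ^ 2 ≤ M * (η ^ 2 + s ^ 2) := by
      have a1 := mul_le_mul_of_nonneg_left hWM (sq_nonneg η)
      have a2 : W ^ 2 ≤ M * s ^ 2 := by
        rw [sq]
        exact mul_le_mul hWM (hWM.trans hMs) hW0 hM.le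
      linarith
    calc M * (η ^ 2 * W + W ^ 2) ≤ M * (M * (η ^ 2 + s ^ 2)) :=
          mul_le_mul_of_nonneg_left h1 hM.le
      _ ≤ (M * (η + s)) ^ 2 := by
          have : 0 ≤ M ^ 2 * (2 * η * s) := by positivity
          nlinarith
  -- Off-diagonal part: 1 + 8² = 65 is rounded up to 9².
  have hB : √(M * (q ^ 4 * W ^ 2 + q ^ 3 * Nm ^ 2 * W)) ≤ M * (9 * q ^ 2 * s) := by
    apply Real.sqrt_le_iff.2
    refine ⟨by positivity, ?_⟩
    have a2 : q ^ 4 * W ^ 2 ≤ q ^ 4 * (M * s ^ 2) := by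
      refine mul_le_mul_of_nonneg_left ?_ (by positivity)
      rw [sq]
      exact mul_le_mul hWM (hWM.trans hMs) hW0 hM.le
    have a3 : Nm ^ 2 ≤ 64 * s ^ 2 := by
      have b1 : Nm ^ 2 ≤ (8 * s ^ 2) ^ 2 := pow_le_pow_left₀ hNm0 (hξ ▸ hNm) 2
      have b2 : (s ^ 2) ^ 2 ≤ s ^ 2 := by nlinarith [sq_nonneg s]
      nlinarith
    have a4 : q ^ 3 * Nm ^ 2 * W ≤ q ^ 4 * (64 * s ^ 2) * M := by
      refine mul_le_mul (mul_le_mul ?_ a3 (sq_nonneg _) (by positivity)) hWM hW0 (by positivity)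
      exact pow_le_pow_right₀ (by linarith) (by norm_num)
    calc M * (q ^ 4 * W ^ 2 + q ^ 3 * Nm ^ 2 * W)
        ≤ M * (q ^ 4 * (M * s ^ 2) + q ^ 4 * (64 * s ^ 2) * M) :=
          mul_le_mul_of_nonneg_left (add_le_add a2 a4) hM.le
      _ = 65 * (M ^ 2 * q ^ 4 * s ^ 2) := by ring
      _ ≤ 81 * (M ^ 2 * q ^ 4 * s ^ 2) := by
          have : 0 ≤ M ^ 2 * q ^ 4 * s ^ 2 := by positivity
          linarith
      _ = (M * (9 * q ^ 2 * s)) ^ 2 := by ring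
  have hq2s : s ≤ q ^ 2 * s := le_mul_of_one_le_left hs (by nlinarith)
  have hqM : q * M ≤ q ^ 2 * s := by nlinarith
  have hq2s0 : 0 ≤ q ^ 2 * s := by positivity
  have hW2 : W ^ 2 ≤ M ^ 2 * (η + 10 * q ^ 2 * s) := by
    have h5 := h4.trans (mul_le_mul_of_nonneg_left (add_le_add hA hB) hM.le)
    have h6 : M * (M * (η + s) + M * (9 * q ^ 2 * s)) ≤ M ^ 2 * (η + 10 * q ^ 2 * s) := by
      have := mul_le_mul_of_nonneg_left hq2s (sq_nonneg M)
      nlinarith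
    exact h5.trans h6
  set x := δ + 2 * q * M
  -- From (1 - x)² ≥ 1 - 2x. Unfolding x then adds 4qM ≤ 4q²s, which turns 10 into 14.
  have hx : 1 - 2 * x ≤ η + 10 * q ^ 2 * s := by
    rcases le_or_gt (1 - x) 0 with hx | hx
    · have : 0 ≤ η + 10 * q ^ 2 * s := by positivity
      linarith
    · have h7 : M ^ 2 * (1 - x) ^ 2 ≤ M ^ 2 * (η + 10 * q ^ 2 * s) := by
        refine le_trans ?_ hW2
        rw [← mul_pow]
        refine pow_le_pow_left₀ (by positivity) ?_ 2
        have e : M * (1 - x) = M * (1 - δ - 2 * q * M) := by simp only [x]; ring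
        rw [e]
        exact hlow
      have h8 := le_of_mul_le_mul_left h7 (by positivity)
      nlinarith [sq_nonneg x]
  simp only [x] at hx
  linarith

variable {F : Type*} [Field F] [Fintype F] {V : Type*} [AddCommGroup V] [Module F V]

/-- The count is (q^(ℓ+1) - 1)/(q - 1), and q ≤ 2(q - 1). -/
lemma card_projectivization_le (ℓ : ℕ) :
    (Fintype.card (ℙ F (Fin (ℓ + 1) → F)) : ℝ) ≤ 2 * (Fintype.card F : ℝ) ^ ℓ := by
  have hq : 2 ≤ Fintype.card F := Fintype.one_lt_card
  have h := Projectivization.card' F (Fin (ℓ + 1) → F)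
  simp only [Nat.card_eq_fintype_card, Fintype.card_fun, Fintype.card_fin] at h
  have h' : (Fintype.card F : ℝ) ^ (ℓ + 1) =
      Fintype.card (ℙ F (Fin (ℓ + 1) → F)) * ((Fintype.card F : ℝ) - 1) + 1 := by
    have := congrArg (Nat.cast : ℕ → ℝ) h
    rw [Nat.cast_add, Nat.cast_mul, Nat.cast_sub (by omega)] at this
    push_cast at this
    exact this
  have hq' : (2 : ℝ) ≤ Fintype.card F := by exact_mod_cast hq
  set N : ℝ := (Fintype.card (ℙ F (Fin (ℓ + 1) → F)) : ℝ)
  set q : ℝ := (Fintype.card F : ℝ)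
  have hpow : 0 < q ^ ℓ := by positivity
  have hN : 0 ≤ N := Nat.cast_nonneg _
  rw [pow_succ] at h'
  by_contra hlt
  push Not at hlt
  nlinarith [mul_lt_mul_of_pos_right hlt (show 0 < q - 1 by linarith)]

variable [Fintype V]

/-- The contrapositive core: a uniform bound η on point densities cannot be much below 1. Requiring
ξ ≤ η lets the same η bound the direction densities, so that every rank one deviation is at most η.
-/
lemma one_sub_le_of_measurePoint_le {ℓ : ℕ} (hℓ : ℓ ≠ 0) (hk : ℓ < Module.finrank F V) {ξ η : ℝ}
    (hξ0 : 0 < ξ) (hξ1 : ξ ≤ 1) {S : Set (AffineSubspace F V)} (hS : S ⊆ flats F V ℓ)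
    (hne : S.Nonempty) (hμ : measure ℓ S ≤ ξ) (hhyp : PseudoRandomHyperplanes ℓ ξ S)
    (hptLin : PseudoRandomPointsLin ℓ ξ S) (hexp : 1 - expansion ℓ S ≥ 1 / (Fintype.card F : ℝ))
    (hξη : ξ ≤ η) (hpt : ∀ x, measurePoint ℓ S x ≤ η) :
    1 - 2 / (Fintype.card F : ℝ) ^ ℓ ≤ η + 14 * (Fintype.card F : ℝ) ^ 2 * √ξ := by
  have hq : (2 : ℝ) ≤ Fintype.card F := by exact_mod_cast Fintype.one_lt_card (α := F)
  have hη : 0 ≤ η := hξ0.le.trans hξη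
  have hMξ := expect_frameInd_le hS hξ0.le hμ
  have hM : 0 < 𝔼 v, frameInd ℓ S v := by
    have hV : (0 : ℝ) < Fintype.card V := by exact_mod_cast Fintype.card_pos
    have hn : (0 : ℝ) < S.ncard := by
      exact_mod_cast (Set.ncard_pos (Set.toFinite S)).2 hne
    rw [expect_frameInd, card_frames hS]
    have := frameCount_self_pos (F := F) (ℓ := ℓ)
    positivity
  have hM2 : 𝔼 v, frameInd ℓ S v ^ 2 = 𝔼 v, frameInd ℓ S v := by simp_rw [frameInd_sq]
  have hdev : ∀ (p : ℙ F (Fin (ℓ + 1) → F)) (z : V), |dev (frameInd ℓ S) p.rep z| ≤ η := by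
    intro p z
    have h1 := condE_frameInd_le hS hη hpt (fun y => (hptLin y).trans hξη) hℓ p.rep_nonzero z
    have h2 : 0 ≤ condE (frameInd ℓ S) p.rep z := by
      classical
      rw [condE_frameInd]
      positivity
    rw [dev, abs_le]
    constructor <;> linarith
  have hhat : ∀ (p : ℙ F (Fin (ℓ + 1) → F)) (ψ : AddChar V ℂ),
      ‖hat (dev (frameInd ℓ S) p.rep) ψ‖ ≤ 4 * ξ / (Fintype.card F : ℝ) ^ ℓ := by
    intro p ψ
    by_cases hψ : ψ = 0
    · rw [hψ, hat_dev_zero, norm_zero]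
      positivity
    · rw [hat_dev _ _ hψ]
      exact norm_hat_frameInd_pull_le hξ0.le hS hμ hhyp hℓ p.rep_nonzero hψ
  have h4 := levelWeight_sq_le (F := F) (frameInd_sq S) hdev hhat
  have hwalk := (le_expect_walk hS hne hℓ hk hexp).trans (expect_walk_le (F := F) (frameInd ℓ S))
  rw [hM2] at hwalk
  have hlow := le_levelWeight_of_walk hq (by positivity) hM.le hwalk
  have hWM := levelWeight_le (F := F) (frameInd ℓ S)
  rw [hM2] at hWM
  have hN := card_projectivization_le (F := F) ℓ
  have hq0 : (0 : ℝ) < (Fintype.card F : ℝ) ^ ℓ := by positivity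
  have hNm : (Fintype.card (ℙ F (Fin (ℓ + 1) → F)) : ℝ) *
      (4 * ξ / (Fintype.card F : ℝ) ^ ℓ) ≤ 8 * ξ := by
    have h1 := mul_le_mul_of_nonneg_right hN
      (show 0 ≤ 4 * ξ / (Fintype.card F : ℝ) ^ ℓ by positivity)
    refine h1.trans (le_of_eq ?_)
    field_simp
    norm_num
  have hfin := one_sub_le_of_levelWeight (δ := 1 / (Fintype.card F : ℝ) ^ ℓ) hq
    (Real.sqrt_nonneg ξ) (Real.sqrt_le_one.2 hξ1) (Real.sq_sqrt hξ0.le).symm hM hMξ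
    (levelWeight_nonneg (F := F) _) hWM hη (by positivity) hNm (by
      refine le_trans (mul_le_mul_of_nonneg_left ?_ hM.le) hlow
      have : 2 * (1 / (Fintype.card F : ℝ) ^ (ℓ + 1)) ≤ 1 / (Fintype.card F : ℝ) ^ ℓ := by
        rw [pow_succ, mul_one_div, div_le_div_iff₀ (by positivity) hq0]
        nlinarith
      simp only [levelWeight, weight] at *
      linarith) h4
  rw [mul_one_div] at hfin
  exact hfin

end Conclusion

end AffGrass

end

theorem theorem5 {F : Type*} [Field F] [Fintype F]
    {V : Type*} [AddCommGroup V] [Module F V] [FiniteDimensional F V]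
    (ℓ : ℕ) (hℓ : ℓ < Module.finrank F V) (ξ : ℝ) (hξ : 0 < ξ)
    (S : Set (AffineSubspace F V)) (hS : S ⊆ AffGrass.flats F V ℓ) (hne : S.Nonempty)
    (hμ : AffGrass.measure ℓ S ≤ ξ)
    (hhyp : AffGrass.PseudoRandomHyperplanes ℓ ξ S)
    (hhypLin : AffGrass.PseudoRandomHyperplanesLin ℓ ξ S)
    (hptLin : AffGrass.PseudoRandomPointsLin ℓ ξ S)
    (hexp : 1 - AffGrass.expansion ℓ S ≥ 1 / (Fintype.card F : ℝ)) :
    ∃ x : V, AffGrass.measurePoint ℓ S x ≥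
      1 - (Fintype.card F : ℝ) ^ 2 *
        (867 * ξ ^ (1 / 4 : ℝ) + (Fintype.card F : ℝ) ^ (-(ℓ : ℤ))) := by
  have : Finite V := Module.finite_of_finite F
  have : Fintype V := Fintype.ofFinite V
  have hq : (2 : ℝ) ≤ Fintype.card F := by exact_mod_cast Fintype.one_lt_card (α := F)
  by_contra! hcon
  have hnn : ∀ x, 0 ≤ AffGrass.measurePoint ℓ S x := fun x => AffGrass.prob_nonneg _ _
  have hτ := (hnn 0).trans_lt (hcon 0)
  rw [zpow_neg, zpow_natCast, ← one_div] at hcon hτ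
  set q : ℝ := (Fintype.card F : ℝ)
  set r : ℝ := ξ ^ (1 / 4 : ℝ)
  have hr : 0 < r := Real.rpow_pos_of_pos hξ _
  have hδ : 0 < 1 / q ^ ℓ := by positivity
  have hq2 : 4 ≤ q ^ 2 := by nlinarith
  have hqr : 4 * r ≤ q ^ 2 * r := mul_le_mul_of_nonneg_right hq2 hr.le
  have hqδ : 4 * (1 / q ^ ℓ) ≤ q ^ 2 * (1 / q ^ ℓ) := mul_le_mul_of_nonneg_right hq2 hδ.le
  have hr1 : r ≤ 1 := by nlinarith
  have hξr : ξ = r ^ 4 := by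
    rw [← Real.rpow_natCast, ← Real.rpow_mul hξ.le]
    norm_num
  have hsr : √ξ = r ^ 2 := by
    rw [hξr, show r ^ 4 = (r ^ 2) ^ 2 by ring, Real.sqrt_sq (by positivity)]
  have hr2 : r ^ 2 ≤ r := by nlinarith
  have hr4 : r ^ 4 ≤ r ^ 2 := pow_le_pow_of_le_one hr.le hr1 (by norm_num)
  -- For ℓ = 0 the claimed lower bound is negative, so it cannot exceed a density.
  have hℓ0 : ℓ ≠ 0 := by
    rintro rfl
    norm_num at hτ
    nlinarith
  have hqr2 : q ^ 2 * r ^ 2 ≤ q ^ 2 * r := mul_le_mul_of_nonneg_left hr2 (by positivity)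
  -- η is the larger of the supposed bound on point densities and ξ. In both cases the resulting
  -- inequality fails: its error 14q²√ξ = 14q²r² is well below 867q²r because r ≤ 1, and 2/q^ℓ is at
  -- most half of q²/q^ℓ because q ≥ 2.
  have main := AffGrass.one_sub_le_of_measurePoint_le hℓ0 hℓ hξ (by linarith) hS hne hμ hhyp hptLin
    hexp (le_max_right (1 - q ^ 2 * (867 * r + 1 / q ^ ℓ)) ξ)
    fun x => (hcon x).le.trans (le_max_left _ _)
  rw [hsr, ← mul_one_div] at main
  rcases max_cases (1 - q ^ 2 * (867 * r + 1 / q ^ ℓ)) ξ with ⟨h, -⟩ | ⟨h, -⟩ <;>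
    rw [h] at main <;> linarith
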